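/- Let $\Lambda=2\omega_1\mathbb Z+2\omega_2\mathbb Z\subset\mathbb C$ be a lattice with Weierstrass function $\sigma$, let $\eta,\lambda\in\mathbb C$ with $\lambda\neq0$, let $N\ge 0$, and let $x_i^m\in\mathbb C$ ($m\in\mathbb Z$, $1\le i\le N$). Put $\tau^m(x)=\prod_{j=1}^N\sigma(x-x_j^m)$. Assume that the zeros are in generic position: $\eta\notin\Lambda$; $x_i^m-x_j^m\notin\Lambda\cup(\eta+\Lambda)\cup(-\eta+\Lambda)$ for all $m$ and $i\ne j$; and $x_i^m-x_j^{m+1}\notin\Lambda\cup(\eta+\Lambda)$ for all $m,i,j$. Consider the linear problem for families $\psi=(\psi^m)_{m\in\mathbb Z}$ of meromorphic functions $$\psi^m(x+\eta)-\lambda\,\frac{\tau^m(x)\,\tau^{m+1}(x+\eta)}{\tau^{m+1}(x)\,\tau^m(x+\eta)}\,\psi^m(x)=\psi^{m+1}(x)\qquad(m\in\mathbb Z)\tag{1}$$ and the equations of motion (discrete-time Ruijsenaars–Schneider system) $$\prod_{k=1}^N\frac{\sigma(x_j^m-x_k^{m-1})\,\sigma(x_j^m-x_k^m+\eta)\,\sigma(x_j^m-x_k^{m+1}-\eta)}{\sigma(x_j^m-x_k^{m-1}+\eta)\,\sigma(x_j^m-x_k^m-\eta)\,\sigma(x_j^m-x_k^{m+1})}=-1\qquad(m\in\mathbb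 Z,\ 1\le j\le N).\tag{2}$$ A solution $\psi$ of (1) is double-Bloch if there are constants $B_1,B_2$ (the Bloch multipliers) with $\psi^m(x+2\omega_a)=B_a\psi^m(x)$ for $a=1,2$ and all $m$. Pairs $(B_1,B_2)$ and $(B_1',B_2')$ are equivalent if $B_a'=B_ae^{2b\omega_a}$, $a=1,2$, for some $b\in\mathbb C$. Double-Bloch solutions $\psi_1,\dots,\psi_N$ with equivalent multipliers $B_{r,a}=B_{0,a}e^{2b_r\omega_a}$ are called independent after normalization if for each $m$ the functions $e^{-b_rx}\psi_r^m(x)$, $1\le r\le N$, which have common multipliers, are linearly independent over $\mathbb C$. (i) Suppose that (1) has $N$ double-Bloch solutions with equivalent Bloch multipliers such that either (a) they are linearly independent over $\mathbb C$ and each $\psi_r^m$ has a simple pole at every point of $x_i^m+\Lambda$, $1\le i\le N$, and no other poles; or (b) they are independent after normalization and each $\psi_r^m$ has at most simple poles, all of them at points of $x_i^m+\Lambda$, $1\le i\le N$. Then (2) holds. (ii) Conversely, suppose that $k\eta\notin\Lambda$ for $0<k<N$. If (2) holds, then (1) has $N$ double-Bloch solutions with equivalent Bloch multipliers which are linearly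 independent over $\mathbb C$, are independent after normalization, and have a simple pole at every point of $x_i^m+\Lambda$, $1\le i\le N$, and no other poles. In particular, if $k\eta\notin\Lambda$ for $0<k<N$, then the existence of $N$ linearly independent double-Bloch solutions with simple poles at the points $x_i^m$ and equivalent Bloch multipliers is equivalent to (2). -/

import Mathlib

open Filter

noncomputable section

namespace DoubleBloch

/- Throughout, `L` is a pair of periods: `L.ω₁` and `L.ω₂` are the full periods `2ω₁`, `2ω₂`
of the elliptic functions, and `L.lattice` is the lattice they generate. -/

/-- The Weierstrass sigma function
`σ(z) = z ∏_{l ≠ 0} (1 - z / l) exp (z / l + z² / (2 l²))` of the lattice of `L`.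
The factor with `l = 0` equals `1` because of the convention `z / 0 = 0`, so it may be kept. -/
def sigma (L : PeriodPair) (z : ℂ) : ℂ :=
  z * ∏' l : L.lattice, (1 - z / (l : ℂ)) * Complex.exp (z / (l : ℂ) + (z / (l : ℂ)) ^ 2 / 2)

/-- The elliptic polynomial of degree `N` with zeros `a 0, …, a (N - 1)`. -/
def ellipticPoly (L : PeriodPair) {N : ℕ} (a : Fin N → ℂ) (z : ℂ) : ℂ :=
  ∏ j, sigma L (z - a j)

/-- All translates by lattice vectors of the points `a i`. -/
def latticeTranslates (L : PeriodPair) {N : ℕ} (a : Fin N → ℂ) : Set ℂ :=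
  {z | ∃ i, z - a i ∈ L.lattice}

/-- The zeros `x m i` are in generic position (all conditions are modulo the lattice). The
condition with `-η` at equal times is the one with `η` for the exchanged indices. -/
structure GenericPosition (L : PeriodPair) (η : ℂ) {N : ℕ} (x : ℤ → Fin N → ℂ) : Prop where
  step : η ∉ L.lattice
  same_time : ∀ m i j, i ≠ j → x m i - x m j ∉ L.lattice ∧ x m i - x m j - η ∉ L.lattice
  next_time : ∀ m i j,
    x m i - x (m + 1) j ∉ L.lattice ∧ x m i - x (m + 1) j - η ∉ L.lattice

/-- The elliptic coefficient
`τ^m(z) τ^{m+1}(z + η) / (τ^{m+1}(z) τ^m(z + η))` of the linear problem. -/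
def coefficient (L : PeriodPair) (η : ℂ) {N : ℕ} (x : ℤ → Fin N → ℂ) (m : ℤ) (z : ℂ) : ℂ :=
  ellipticPoly L (x m) z * ellipticPoly L (x (m + 1)) (z + η) /
    (ellipticPoly L (x (m + 1)) z * ellipticPoly L (x m) (z + η))

/-- The linear problem `ψ^m(z + η) - lam · coefficient · ψ^m(z) = ψ^{m+1}(z)` for all `m`, as an
equality of meromorphic functions (that is, off a closed discrete set). -/
def LinearProblem (L : PeriodPair) (η lam : ℂ) {N : ℕ} (x : ℤ → Fin N → ℂ)
    (ψ : ℤ → ℂ → ℂ) : Prop :=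
  ∀ m, (fun z => ψ m (z + η) - lam * coefficient L η x m z * ψ m z) =ᶠ[codiscrete ℂ] ψ (m + 1)

/-- `f` is a double-Bloch function with Bloch multipliers `B.1`, `B.2`. -/
structure IsDoubleBloch (L : PeriodPair) (B : ℂ × ℂ) (f : ℂ → ℂ) : Prop where
  meromorphic : Meromorphic f
  bloch₁ : (fun z => f (z + L.ω₁)) =ᶠ[codiscrete ℂ] fun z => B.1 * f z
  bloch₂ : (fun z => f (z + L.ω₂)) =ᶠ[codiscrete ℂ] fun z => B.2 * f z

/-- The multipliers of `z ↦ f z * exp (b * z)`, if `B` are those of `f`. -/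
def gauge (L : PeriodPair) (b : ℂ) (B : ℂ × ℂ) : ℂ × ℂ :=
  (B.1 * Complex.exp (b * L.ω₁), B.2 * Complex.exp (b * L.ω₂))

/-- Equivalence of pairs of Bloch multipliers. -/
def EquivalentMultipliers (L : PeriodPair) (B B' : ℂ × ℂ) : Prop :=
  ∃ b : ℂ, B' = gauge L b B

/-- `f` has at most simple poles, all of them in `S`. -/
def AtMostSimplePoles (S : Set ℂ) (f : ℂ → ℂ) : Prop :=
  (∀ z ∉ S, 0 ≤ meromorphicOrderAt f z) ∧ ∀ z ∈ S, -1 ≤ meromorphicOrderAt f z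

/-- `f` has a simple pole at every point of `S` and no other poles. -/
def SimplePolesExactlyAt (S : Set ℂ) (f : ℂ → ℂ) : Prop :=
  (∀ z ∉ S, 0 ≤ meromorphicOrderAt f z) ∧ ∀ z ∈ S, meromorphicOrderAt f z = -1

/-- `ψ 0, …, ψ (N - 1)` are double-Bloch solutions of the linear problem, the multipliers `B r` of
`ψ r` (the same for all `m`) being pairwise equivalent. -/
structure IsSolutionSystem (L : PeriodPair) (η lam : ℂ) {N : ℕ} (x : ℤ → Fin N → ℂ)
    (ψ : Fin N → ℤ → ℂ → ℂ) (B : Fin N → ℂ × ℂ) : Prop where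
  solves : ∀ r, LinearProblem L η lam x (ψ r)
  doubleBloch : ∀ r m, IsDoubleBloch L (B r) (ψ r m)
  equivalent : ∀ r s, EquivalentMultipliers L (B r) (B s)

/-- Linear independence over `ℂ` of the solutions `ψ r = (ψ r m)_m`, as families of meromorphic
functions. -/
def Independent {N : ℕ} (ψ : Fin N → ℤ → ℂ → ℂ) : Prop :=
  ∀ c : Fin N → ℂ,
    (∀ m, (fun z => ∑ r, c r * ψ r m z) =ᶠ[codiscrete ℂ] fun _ => 0) → ∀ r, c r = 0

/-- After the gauge transformations `ψ r m z ↦ exp (-(b r) z) ψ r m z` that give all solutions the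
same Bloch multipliers `B₀`, the functions are linearly independent over `ℂ` for each `m`. -/
def NormalizedIndependent (L : PeriodPair) {N : ℕ} (ψ : Fin N → ℤ → ℂ → ℂ)
    (B : Fin N → ℂ × ℂ) : Prop :=
  ∃ (B₀ : ℂ × ℂ) (b : Fin N → ℂ), (∀ r, B r = gauge L (b r) B₀) ∧
    ∀ (m : ℤ) (c : Fin N → ℂ),
      ((fun z => ∑ r, c r * (Complex.exp (-(b r * z)) * ψ r m z)) =ᶠ[codiscrete ℂ] fun _ => 0) →
        ∀ r, c r = 0

/-- The equations of motion of the zeros (discrete-time Ruijsenaars–Schneider system). -/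
def EquationsOfMotion (L : PeriodPair) (η : ℂ) {N : ℕ} (x : ℤ → Fin N → ℂ) : Prop :=
  ∀ (m : ℤ) (j : Fin N),
    ∏ k, (sigma L (x m j - x (m - 1) k) * sigma L (x m j - x m k + η) *
          sigma L (x m j - x (m + 1) k - η)) /
        (sigma L (x m j - x (m - 1) k + η) * sigma L (x m j - x m k - η) *
          sigma L (x m j - x (m + 1) k)) = -1

end DoubleBloch

end

open DoubleBloch

/-! Necessity. Multiplying a solution by `τ^m` gives entire functions `F m` satisfying a functional
equation. Each of its three terms contains a shifted `τ`; evaluating at a zero of one of them leaves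
a relation between two values of `F`. Three such relations at `y = x (m+1) j` eliminate to the
equation of motion times `F m y`. A genuine pole makes `F m y` non-zero, so one solution suffices in
case (a). In case (b), if the equation failed, all residues at `y` would vanish, so some non-trivial
combination of the `N` normalized solutions would have no poles. It would also vanish at `y - η`,
and a pole-free double-Bloch function with a zero is zero (`eq_zero_of_bloch`), against
independence.

Sufficiency. The ansatz is `ψ = exp (b z) F / τ^m` with `F = thetaSum` built from residues `c` and a
spectral parameter `u`. Absence of poles at `x m i - η` says that `c` is an eigenvector of the
matrix `lax` with eigenvalue `k = exp (b η)`. An eigenvector determines its successor `c'` because a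
theta function of degree `2N` with `2N` zeros of the wrong sum vanishes (`exists_isStep`); the
equations of motion say that `c'` is again an eigenvector for the same `k`
(`IsStep.mulVec_eq_smul`).

It remains to find one `u` for which all these matrices have simple spectrum and eigenvectors
without zero entries. The characteristic polynomial is studied over the field of meromorphic
functions of `u`. Its coefficients have only simple poles on the lattice, since the residue of the
matrix has rank one, and a period shift of `u` merely rescales its roots. A proper monic factor
shared with another such polynomial splits it into two factors of the same symmetry. By Gauss's
lemma one of them, of degree `d < N`, has no poles; its constant coefficient is then a pole-free
function with the multipliers of `σ(u - dη) / σ(u)`, which vanishes because `dη` is not in the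
lattice. So the determinant would vanish identically, which is false. This argument
(`IsTwisted.isCoprime`) is applied with the derivative and with the characteristic polynomials of
principal minors. Distinct eigenvalues yield distinct exponents `b`, hence both kinds of
independence. -/

open DoubleBloch

/-! ### The sigma function: convergence, zeros and quasi-periodicity -/

noncomputable section

namespace DoubleBloch

open scoped Topology

/-- The elementary factor `(1 - t) exp (t + t² / 2)` of genus two. -/
def elementaryFactor (t : ℂ) : ℂ := (1 - t) * Complex.exp (t + t ^ 2 / 2)

/-- The exponent is the second Taylor polynomial of `-log (1 - t)`, so the terms of order one and
two cancel. The cubic order matches the convergence of the sum of `‖l‖ ^ (-3)` over the lattice. -/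
lemma norm_elementaryFactor_sub_one_le {t : ℂ} (ht : ‖t‖ ≤ 1 / 2) :
    ‖elementaryFactor t - 1‖ ≤ 2 * ‖t‖ ^ 3 := by
  set w := t + t ^ 2 / 2 with hw
  have h0 := norm_nonneg t
  have hwt : ‖w‖ ≤ 5 / 4 * ‖t‖ := by
    refine (norm_add_le _ _).trans ?_
    rw [norm_div, norm_pow, Complex.norm_ofNat]
    nlinarith
  have he := Complex.exp_bound (x := w) (by linarith) (n := 3) (by norm_num)
  have hs : ∑ m ∈ Finset.range 3, w ^ m / (m.factorial : ℂ) = 1 + w + w ^ 2 / 2 := by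
    simp [Finset.sum_range_succ]
  rw [hs] at he
  have he' : ‖Complex.exp w - (1 + w + w ^ 2 / 2)‖ ≤ ‖w‖ ^ 3 * (2 / 9) := by
    refine he.trans (le_of_eq ?_)
    norm_num [Nat.factorial]
  have key : elementaryFactor t - 1 = (1 - t) * (Complex.exp w - (1 + w + w ^ 2 / 2))
      + t ^ 3 * (-1 / 2 - 3 / 8 * t - 1 / 8 * t ^ 2) := by
    rw [elementaryFactor, ← hw]
    rw [show (1 - t) * (Complex.exp w - (1 + w + w ^ 2 / 2)) =
      (1 - t) * Complex.exp w - (1 - t) * (1 + w + w ^ 2 / 2) by ring]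
    rw [hw]; ring
  have h1 : ‖1 - t‖ ≤ 3 / 2 := by
    refine (norm_sub_le _ _).trans ?_
    rw [norm_one]; linarith
  have h2 : ‖(-1 / 2 - 3 / 8 * t - 1 / 8 * t ^ 2 : ℂ)‖ ≤ 1 := by
    refine (norm_sub_le _ _).trans ?_
    have h3 := norm_sub_le (-1 / 2 : ℂ) (3 / 8 * t)
    simp only [norm_mul, norm_div, norm_pow, norm_neg, norm_one, Complex.norm_ofNat] at h3 ⊢
    nlinarith
  have h3 : ‖w‖ ^ 3 ≤ (5 / 4 * ‖t‖) ^ 3 := pow_le_pow_left₀ (norm_nonneg _) hwt 3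
  rw [key]
  calc _ ≤ ‖1 - t‖ * ‖Complex.exp w - (1 + w + w ^ 2 / 2)‖
        + ‖t‖ ^ 3 * ‖(-1 / 2 - 3 / 8 * t - 1 / 8 * t ^ 2 : ℂ)‖ := by
        refine (norm_add_le _ _).trans (le_of_eq ?_)
        rw [norm_mul, norm_mul, norm_pow]
    _ ≤ 3 / 2 * ((5 / 4 * ‖t‖) ^ 3 * (2 / 9)) + ‖t‖ ^ 3 * 1 := by
        gcongr
        exact he'.trans (by gcongr)
    _ ≤ 2 * ‖t‖ ^ 3 := by nlinarith [pow_nonneg h0 3]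

variable (L : PeriodPair)

lemma summable_norm_lattice_rpow : Summable fun l : L.lattice => ‖(l : ℂ)‖ ^ (-3 : ℝ) :=
  ZLattice.summable_norm_rpow _ _ (by simp; norm_num)

lemma eventually_cofinite_le_norm (R : ℝ) : ∀ᶠ l : L.lattice in cofinite, R ≤ ‖(l : ℂ)‖ := by
  refine (isCompact_iff_finite.mp (isCompact_closedBall (0 : L.lattice) R)).subset ?_
  intro l hl
  simp only [Set.mem_compl_iff, Set.mem_ofPred_eq, not_le] at hl
  simpa using hl.le

lemma norm_elementaryFactor_div_sub_one_le {r : ℝ} (hr : 0 < r) {z l : ℂ} (hz : ‖z‖ ≤ r)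
    (hl : 2 * r ≤ ‖l‖) :
    ‖elementaryFactor (z / l) - 1‖ ≤ 2 * r ^ 3 * ‖l‖ ^ (-3 : ℝ) := by
  have hl0 : 0 < ‖l‖ := by linarith
  refine (norm_elementaryFactor_sub_one_le ?_).trans ?_
  · rw [norm_div, div_le_iff₀ hl0]; linarith
  · rw [norm_div, div_pow, Real.rpow_neg hl0.le, mul_assoc, div_eq_mul_inv]
    norm_cast
    gcongr

/-- The Weierstrass product without the factor `z`. -/
def sigmaProd (z : ℂ) : ℂ := ∏' l : L.lattice, elementaryFactor (z / (l : ℂ))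

lemma sigma_eq (z : ℂ) : sigma L z = z * sigmaProd L z := rfl

lemma differentiable_elementaryFactor_div (l : ℂ) :
    Differentiable ℂ fun z => elementaryFactor (z / l) := by
  unfold elementaryFactor; fun_prop

lemma hasProdLocallyUniformlyOn_sigmaProd (s : Set ℂ) (hs : IsOpen s) :
    HasProdLocallyUniformlyOn (fun (l : L.lattice) z => elementaryFactor (z / (l : ℂ)))
      (sigmaProd L) s := by
  apply hasProdLocallyUniformlyOn_of_forall_compact hs
  intro K _ hK
  obtain ⟨r, hr, hKr⟩ : ∃ r > 0, ∀ z ∈ K, ‖z‖ ≤ r := by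
    obtain ⟨r, hr⟩ := hK.isBounded.exists_norm_le
    exact ⟨max r 1, by positivity, fun z hz => (hr z hz).trans (le_max_left _ _)⟩
  have := Summable.hasProdUniformlyOn_one_add hK
    ((summable_norm_lattice_rpow L).mul_left (2 * r ^ 3))
    (f := fun (l : L.lattice) z => elementaryFactor (z / (l : ℂ)) - 1) ?_ ?_
  · simp only [add_sub_cancel] at this
    exact this
  · filter_upwards [eventually_cofinite_le_norm L (2 * r)] with l hl z hz
    exact norm_elementaryFactor_div_sub_one_le hr (hKr z hz) hl
  · intro l
    exact ((differentiable_elementaryFactor_div _).continuous.sub continuous_const).continuousOn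

lemma differentiable_sigmaProd : Differentiable ℂ (sigmaProd L) := by
  rw [← differentiableOn_univ]
  refine (hasProdLocallyUniformlyOn_sigmaProd L _ isOpen_univ).differentiableOn
    (.of_forall fun s => ?_) isOpen_univ
  rw [differentiableOn_univ]
  exact Differentiable.fun_finsetProd fun i _ => differentiable_elementaryFactor_div (i : ℂ)

lemma differentiable_sigma : Differentiable ℂ (sigma L) :=
  differentiable_id.mul (differentiable_sigmaProd L)

@[fun_prop]
lemma Differentiable.sigma {f : ℂ → ℂ} (hf : Differentiable ℂ f) :
    Differentiable ℂ fun z => sigma L (f z) :=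
  (differentiable_sigma L).comp hf

/-- The hypothesis admits `z = 0`, which is what makes the zero of `sigma` at the origin simple. -/
lemma sigmaProd_ne_zero {z : ℂ} (hz : z ∈ L.lattice → z = 0) : sigmaProd L z ≠ 0 := by
  have := tprod_one_add_ne_zero_of_summable
    (f := fun l : L.lattice => elementaryFactor (z / (l : ℂ)) - 1) ?_ ?_
  · simpa [sigmaProd] using this
  · intro l
    simp only [add_sub_cancel, elementaryFactor]
    refine mul_ne_zero (fun h => ?_) (Complex.exp_ne_zero _)
    rw [sub_eq_zero, eq_comm] at h
    have hl : (l : ℂ) ≠ 0 := by rintro h'; simp [h'] at h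
    rw [div_eq_one_iff_eq hl] at h
    rw [hz (h ▸ l.2)] at h
    exact hl h.symm
  · refine Summable.of_norm_bounded_eventually
      ((summable_norm_lattice_rpow L).mul_left (2 * (‖z‖ + 1) ^ 3)) ?_
    filter_upwards [eventually_cofinite_le_norm L (2 * (‖z‖ + 1))] with l hl
    rw [norm_norm]
    exact norm_elementaryFactor_div_sub_one_le (by positivity) (by linarith) hl

lemma sigma_ne_zero {z : ℂ} (hz : z ∉ L.lattice) : sigma L z ≠ 0 :=
  mul_ne_zero (by rintro rfl; simp at hz) (sigmaProd_ne_zero L fun h => absurd h hz)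

lemma sigma_eq_zero {z : ℂ} (hz : z ∈ L.lattice) : sigma L z = 0 := by
  by_cases h : z = 0
  · simp [sigma_eq, h]
  · rw [sigma_eq, sigmaProd, tprod_of_exists_eq_zero ⟨⟨z, hz⟩, ?_⟩, mul_zero]
    simp [elementaryFactor, h]

lemma sigma_eq_zero_iff {z : ℂ} : sigma L z = 0 ↔ z ∈ L.lattice :=
  ⟨fun h => by_contra fun hz => sigma_ne_zero L hz h, sigma_eq_zero L⟩

lemma meromorphicOrderAt_sigma_zero : meromorphicOrderAt (sigma L) 0 = 1 := by
  rw [show (1 : WithTop ℤ) = ((1 : ℤ) : WithTop ℤ) from rfl,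
    meromorphicOrderAt_eq_int_iff ((differentiable_sigma L).analyticAt 0).meromorphicAt]
  exact ⟨sigmaProd L, (differentiable_sigmaProd L).analyticAt 0,
    sigmaProd_ne_zero L fun _ => rfl, .of_forall fun z => by simp [sigma_eq]⟩

/-- The Weierstrass zeta function, with value `0` for the singular terms. -/
def weierstrassZeta (z : ℂ) : ℂ := ∑' l : L.lattice, (1 / (z - l) + 1 / l + z / (l : ℂ) ^ 2)

lemma hasSumLocallyUniformly_weierstrassZeta :
    HasSumLocallyUniformly (fun (l : L.lattice) (z : ℂ) =>
      1 / (z - l) + 1 / l + z / (l : ℂ) ^ 2) (weierstrassZeta L) := by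
  refine L.hasSumLocallyUniformly_aux (u := (2 * · ^ 2 * ‖·‖ ^ (-3 : ℝ))) _
    (fun _ _ => (ZLattice.summable_norm_rpow _ _ (by simp; norm_num)).mul_left _) fun r hr =>
    Filter.eventually_atTop.mpr ⟨2 * r, ?_⟩
  rintro _ h z hz l rfl
  have hl0 : 0 < ‖(l : ℂ)‖ := by linarith
  have hl : (l : ℂ) ≠ 0 := norm_pos_iff.mp hl0
  have hd : ‖(l : ℂ)‖ / 2 ≤ ‖z - l‖ := by
    have := norm_sub_norm_le (l : ℂ) z
    rw [norm_sub_rev] at this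
    linarith
  have hzl : z - l ≠ 0 := norm_pos_iff.mp (by linarith)
  have : 1 / (z - l) + 1 / l + z / (l : ℂ) ^ 2 = z ^ 2 / ((l : ℂ) ^ 2 * (z - l)) := by
    field_simp; ring
  rw [this, norm_div, norm_pow, norm_mul, norm_pow, div_le_iff₀ (by positivity),
    show ‖l‖ = ‖(l : ℂ)‖ from rfl, Real.rpow_neg hl0.le]
  norm_cast
  calc ‖z‖ ^ 2 ≤ r ^ 2 := by gcongr
    _ = 2 * r ^ 2 * (‖(l : ℂ)‖ ^ 3)⁻¹ * (‖(l : ℂ)‖ ^ 2 * (‖(l : ℂ)‖ / 2)) := by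
      field_simp
    _ ≤ _ := by gcongr <;> exact le_of_eq rfl

lemma isOpen_compl_lattice : IsOpen ((L.lattice : Set ℂ)ᶜ) := L.isClosed_lattice.isOpen_compl

lemma countable_lattice : (L.lattice : Set ℂ).Countable := by
  have : Countable L.lattice := L.latticeEquivProd.toEquiv.countable_iff.mpr inferInstance
  exact Set.to_countable _

lemma isPreconnected_compl_lattice : IsPreconnected ((L.lattice : Set ℂ)ᶜ) :=
  ((countable_lattice L).isConnected_compl_of_one_lt_rank (by simp)).isPreconnected

lemma sub_ne_zero_of_notMem_lattice {z : ℂ} (hz : z ∉ L.lattice) (l : L.lattice) :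
    z - l ≠ 0 := by
  rw [sub_ne_zero]; rintro rfl; exact hz l.2

lemma hasDerivAt_zetaTerm {z : ℂ} (hz : z ∉ L.lattice) (l : L.lattice) :
    HasDerivAt (fun z : ℂ => 1 / (z - l) + 1 / l + z / (l : ℂ) ^ 2)
      (-(1 / (z - l) ^ 2 - 1 / (l : ℂ) ^ 2)) z := by
  have h := sub_ne_zero_of_notMem_lattice L hz l
  have h1 : HasDerivAt (fun z : ℂ => 1 / (z - l)) (-(1 / (z - l) ^ 2)) z := by
    have := ((hasDerivAt_id' z).sub_const (l : ℂ)).fun_inv h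
    simpa [neg_div] using this
  have h2 := (h1.add_const (1 / (l : ℂ))).add ((hasDerivAt_id' z).div_const ((l : ℂ) ^ 2))
  exact h2.congr_deriv (by ring)

lemma deriv_weierstrassZeta {z : ℂ} (hz : z ∉ L.lattice) :
    deriv (weierstrassZeta L) z = -L.weierstrassP z := by
  have h := ((hasSumLocallyUniformly_weierstrassZeta L).hasSumLocallyUniformlyOn (s :=
    (L.lattice : Set ℂ)ᶜ)).deriv (.of_forall fun s => ?_) (isOpen_compl_lattice L)
  · refine tendsto_nhds_unique (h.tendsto_at hz) ?_
    have := (L.hasSum_weierstrassP z).neg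
    refine this.congr fun s => ?_
    simp only [Function.comp_apply]
    exact (HasDerivAt.fun_sum fun l _ => hasDerivAt_zetaTerm L hz l).deriv.symm
  · exact fun w hw => (HasDerivAt.fun_sum fun l _ =>
      hasDerivAt_zetaTerm L hw l).differentiableAt.differentiableWithinAt

lemma differentiableOn_weierstrassZeta :
    DifferentiableOn ℂ (weierstrassZeta L) (L.lattice : Set ℂ)ᶜ := by
  refine ((hasSumLocallyUniformly_weierstrassZeta L).hasSumLocallyUniformlyOn).differentiableOn
    (.of_forall fun s => ?_) (isOpen_compl_lattice L)
  exact fun w hw => (HasDerivAt.fun_sum fun l _ =>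
      hasDerivAt_zetaTerm L hw l).differentiableAt.differentiableWithinAt

lemma hasDerivAt_elementaryFactor (t : ℂ) :
    HasDerivAt elementaryFactor (-t ^ 2 * Complex.exp (t + t ^ 2 / 2)) t := by
  have h1 : HasDerivAt (fun t : ℂ => t + t ^ 2 / 2) (1 + t) t := by
    exact ((hasDerivAt_id' t).add (((hasDerivAt_id' t).fun_pow 2).div_const 2)).congr_deriv
      (by simp)
  exact (((hasDerivAt_id' t).const_sub 1).mul h1.cexp).congr_deriv (by ring)

lemma logDeriv_elementaryFactor_div {z : ℂ} (hz : z ∉ L.lattice) (l : L.lattice) :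
    logDeriv (fun z => elementaryFactor (z / (l : ℂ))) z =
      if l = 0 then 0 else 1 / (z - l) + 1 / l + z / (l : ℂ) ^ 2 := by
  split_ifs with hl
  · simp [hl]
  · have hl' : (l : ℂ) ≠ 0 := by simpa using hl
    have h := sub_ne_zero_of_notMem_lattice L hz l
    have h1 : HasDerivAt (fun z => elementaryFactor (z / (l : ℂ)))
        (-(z / l) ^ 2 * Complex.exp (z / l + (z / l) ^ 2 / 2) * (1 / l)) z :=
      HasDerivAt.comp (h₂ := elementaryFactor) z (hasDerivAt_elementaryFactor (z / l))
        ((hasDerivAt_id' z).div_const (l : ℂ))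
    rw [logDeriv_apply, h1.deriv, elementaryFactor]
    have h2 : 1 - z / (l : ℂ) = -(z - l) / l := by field_simp; ring
    have := Complex.exp_ne_zero (z / l + (z / l) ^ 2 / 2)
    rw [h2]
    field_simp
    ring

lemma logDeriv_sigma {z : ℂ} (hz : z ∉ L.lattice) :
    logDeriv (sigma L) z = weierstrassZeta L z := by
  have hz0 : z ≠ 0 := by rintro rfl; simp at hz
  have hp : sigmaProd L z ≠ 0 := sigmaProd_ne_zero L fun h => absurd h hz
  have hs : HasSum (fun l : L.lattice => 1 / (z - l) + 1 / (l : ℂ) + z / (l : ℂ) ^ 2)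
      (weierstrassZeta L z) := (hasSumLocallyUniformly_weierstrassZeta L).hasSum
  have hs0 := hs.update 0 (0 : ℂ)
  -- For `l = 0` the factor of the product is the constant `1`, while the zeta term is `1 / z`; the
  -- latter comes from the separate factor `z` of `sigma`.
  have hfun : Function.update (fun l : L.lattice => 1 / (z - l) + 1 / (l : ℂ) + z / (l : ℂ) ^ 2)
      0 0 = fun l : L.lattice => logDeriv (fun z => elementaryFactor (z / (l : ℂ))) z := by
    ext l
    rw [logDeriv_elementaryFactor_div L hz]
    by_cases hl : l = 0 <;> simp [hl]
  rw [hfun] at hs0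
  have h1 : logDeriv (sigmaProd L) z = weierstrassZeta L z - 1 / z := by
    have := logDeriv_tprod_eq_tsum (isOpen_compl_lattice L) (x := z) hz
      (f := fun (l : L.lattice) z => elementaryFactor (z / (l : ℂ))) ?_
      (fun l => (differentiable_elementaryFactor_div _).differentiableOn) hs0.summable
      (hasProdLocallyUniformlyOn_sigmaProd L _ (isOpen_compl_lattice L)).multipliableLocallyUniformlyOn
      hp
    · rw [hs0.tsum_eq] at this
      change logDeriv (sigmaProd L) z = _ at this
      rw [this]; simp [sub_eq_neg_add]
    · intro l h
      exact hp (tprod_of_exists_eq_zero ⟨l, h⟩)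
  have h2 : sigma L = fun z => id z * sigmaProd L z := rfl
  rw [h2, logDeriv_mul z hz0 hp differentiableAt_id (differentiable_sigmaProd L z), h1]
  simp [logDeriv_apply]

/-- Translation by a period multiplies `sigma` by the exponential of an affine function. -/
lemma exists_sigma_add_period (w : L.lattice) :
    ∃ e C : ℂ, C ≠ 0 ∧ ∀ z, sigma L (z + w) = C * Complex.exp (e * z) * sigma L z := by
  have hmem : ∀ z, z + (w : ℂ) ∈ L.lattice ↔ z ∈ L.lattice := fun z =>
    L.lattice.add_mem_iff_left w.2
  have hadd : ∀ z ∈ (L.lattice : Set ℂ)ᶜ, z + (w : ℂ) ∈ (L.lattice : Set ℂ)ᶜ := fun z hz h =>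
    hz ((hmem z).1 h)
  have hd2 : DifferentiableOn ℂ (fun z => weierstrassZeta L (z + w)) (L.lattice : Set ℂ)ᶜ :=
    (differentiableOn_weierstrassZeta L).comp (by fun_prop) hadd
  -- The function `ζ(z + w) - ζ(z)` has derivative `℘(z) - ℘(z + w) = 0`, and the complement of the
  -- countable lattice is connected. Integrating the logarithmic derivative once more gives the
  -- factor `C`.
  obtain ⟨e, he⟩ := (isOpen_compl_lattice L).exists_is_const_of_deriv_eq_zero
    (isPreconnected_compl_lattice L)
    (hd2.sub (differentiableOn_weierstrassZeta L)) (by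
      intro z hz
      have ho := (isOpen_compl_lattice L).mem_nhds hz
      rw [deriv_sub (hd2.differentiableAt ho)
        ((differentiableOn_weierstrassZeta L).differentiableAt ho), deriv_comp_add_const,
        deriv_weierstrassZeta L hz, deriv_weierstrassZeta L (hadd z hz), L.weierstrassP_add_coe]
      simp)
  have hlog : Set.EqOn (logDeriv fun z => sigma L (z + w))
      (logDeriv fun z => Complex.exp (e * z) * sigma L z) (L.lattice : Set ℂ)ᶜ := by
    intro z hz
    have hd : HasDerivAt (fun z => Complex.exp (e * z)) (Complex.exp (e * z) * e) z := by
      simpa using ((hasDerivAt_id z).const_mul e).cexp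
    have h1 : logDeriv (fun z => sigma L (z + w)) z = weierstrassZeta L (z + w) := by
      rw [← logDeriv_sigma L (hadd z hz), logDeriv_apply, logDeriv_apply, deriv_comp_add_const]
    rw [h1, logDeriv_mul (f := fun z => Complex.exp (e * z)) z (Complex.exp_ne_zero _) (sigma_ne_zero L hz) hd.differentiableAt
      (differentiable_sigma L z), logDeriv_sigma L hz, logDeriv_apply, hd.deriv,
      mul_div_cancel_left₀ _ (Complex.exp_ne_zero _), ← he z hz]
    simp
  rw [logDeriv_eqOn_iff (by fun_prop) (by fun_prop)
    (isOpen_compl_lattice L) (isPreconnected_compl_lattice L)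
    (fun z hz => mul_ne_zero (Complex.exp_ne_zero _) (sigma_ne_zero L hz))
    (fun z hz => sigma_ne_zero L (hadd z hz))] at hlog
  obtain ⟨C, hC, h⟩ := hlog
  refine ⟨e, C, hC, fun z => ?_⟩
  by_cases hz : z ∈ L.lattice
  · rw [sigma_eq_zero L hz, sigma_eq_zero L ((hmem z).2 hz), mul_zero]
  · simpa [mul_assoc] using h hz

end DoubleBloch

end

noncomputable section
namespace DoubleBloch
open scoped Topology

/-! ### Meromorphic functions up to closed discrete sets -/

section Codiscrete

lemma nhdsNE_le_codiscrete (z : ℂ) : 𝓝[≠] z ≤ codiscrete ℂ := by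
  intro s hs
  have := mem_codiscrete.1 hs z
  rwa [disjoint_principal_right, compl_compl] at this

lemma eventually_codiscrete_iff {p : ℂ → Prop} :
    (∀ᶠ z in codiscrete ℂ, p z) ↔ ∀ z, ∀ᶠ w in 𝓝[≠] z, p w := by
  refine ⟨fun h z => h.filter_mono (nhdsNE_le_codiscrete z), fun h => ?_⟩
  refine mem_codiscrete.2 fun z => ?_
  rw [disjoint_principal_right, compl_compl]
  exact h z

lemma tendsto_add_const_codiscrete (c : ℂ) :
    Tendsto (fun z => z + c) (codiscrete ℂ) (codiscrete ℂ) := by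
  intro s hs
  refine eventually_codiscrete_iff.2 fun z => ?_
  have h1 : Tendsto (fun w => w + c) (𝓝[≠] z) (𝓝[≠] (z + c)) := by
    refine tendsto_nhdsWithin_iff.2 ⟨?_, ?_⟩
    · exact ((continuous_add_const c).tendsto z).mono_left nhdsWithin_le_nhds
    · filter_upwards [self_mem_nhdsWithin] with w hw
      simpa using hw
  exact h1.eventually (eventually_codiscrete_iff.1 hs (z + c))

instance : (codiscrete ℂ).NeBot := neBot_of_le (nhdsNE_le_codiscrete 0)

lemma eq_of_eventuallyEq_codiscrete {f g : ℂ → ℂ} (hf : Continuous f) (hg : Continuous g)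
    (h : f =ᶠ[codiscrete ℂ] g) : f = g := by
  funext z
  have h1 : Tendsto f (𝓝[≠] z) (𝓝 (f z)) := hf.continuousAt.tendsto.mono_left nhdsWithin_le_nhds
  have h2 : Tendsto g (𝓝[≠] z) (𝓝 (g z)) := hg.continuousAt.tendsto.mono_left nhdsWithin_le_nhds
  exact tendsto_nhds_unique_of_eventuallyEq h1 h2 (h.filter_mono (nhdsNE_le_codiscrete z))

lemma meromorphicOrderAt_congr_codiscrete {f g : ℂ → ℂ} (h : f =ᶠ[codiscrete ℂ] g) (z : ℂ) :
    meromorphicOrderAt f z = meromorphicOrderAt g z :=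
  meromorphicOrderAt_congr (h.filter_mono (nhdsNE_le_codiscrete z))

lemma _root_.Differentiable.meromorphic {f : ℂ → ℂ} (hf : Differentiable ℂ f) : Meromorphic f :=
  fun z => (hf.analyticAt z).meromorphicAt

lemma exists_differentiable_of_meromorphicOrderAt_nonneg {f : ℂ → ℂ} (hf : Meromorphic f)
    (h : ∀ z, 0 ≤ meromorphicOrderAt f z) :
    ∃ g : ℂ → ℂ, Differentiable ℂ g ∧ f =ᶠ[codiscrete ℂ] g := by
  have hf' : MeromorphicOn f Set.univ := hf.meromorphicOn
  refine ⟨toMeromorphicNFOn f Set.univ, fun z => ?_, toMeromorphicNFOn_eqOn_codiscrete hf'⟩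
  have h1 : MeromorphicNFAt (toMeromorphicNFOn f Set.univ) z :=
    meromorphicNFOn_toMeromorphicNFOn f Set.univ (Set.mem_univ z)
  refine (h1.meromorphicOrderAt_nonneg_iff_analyticAt.1 ?_).differentiableAt
  rw [meromorphicOrderAt_toMeromorphicNFOn hf' (Set.mem_univ z)]
  exact h z

lemma meromorphicOrderAt_eq_top_of_exists {f : ℂ → ℂ} (hf : Meromorphic f) {z : ℂ}
    (h : meromorphicOrderAt f z = ⊤) : f =ᶠ[codiscrete ℂ] 0 := by
  refine eventually_codiscrete_iff.2 fun w => meromorphicOrderAt_eq_top_iff.1 ?_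
  by_contra hw
  exact (hf.meromorphicOn (s := Set.univ)).meromorphicOrderAt_ne_top_of_isPreconnected
    isPreconnected_univ (Set.mem_univ w) (Set.mem_univ z) hw h

/-- A meromorphic function vanishes or is almost nowhere zero. -/
lemma _root_.Meromorphic.eventuallyEq_zero_or_eventually_ne_zero {f : ℂ → ℂ}
    (hf : Meromorphic f) : f =ᶠ[codiscrete ℂ] 0 ∨ ∀ᶠ z in codiscrete ℂ, f z ≠ 0 := by
  by_cases h : ∃ z, meromorphicOrderAt f z = ⊤
  · exact Or.inl (meromorphicOrderAt_eq_top_of_exists hf h.choose_spec)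
  · push Not at h
    exact Or.inr (eventually_codiscrete_iff.2 fun z =>
      (meromorphicOrderAt_ne_top_iff_eventually_ne_zero (hf z)).1 (h z))

lemma eq_zero_of_meromorphicOrderAt_pos {f : ℂ → ℂ} (hf : Differentiable ℂ f) {z : ℂ}
    (h : 1 ≤ meromorphicOrderAt f z) : f z = 0 := by
  have h0 : 0 < meromorphicOrderAt f z := lt_of_lt_of_le (by norm_num) h
  exact tendsto_nhds_unique
    (hf.continuous.continuousAt.tendsto.mono_left nhdsWithin_le_nhds)
    (tendsto_zero_of_meromorphicOrderAt_pos h0)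

lemma one_le_of_pos {n : WithTop ℤ} (h : 0 < n) : 1 ≤ n := by
  cases n with
  | top => exact le_top
  | coe n =>
    have h' : (0 : ℤ) < n := by exact_mod_cast h
    have : (1 : ℤ) ≤ n := h'
    exact_mod_cast this

lemma one_le_meromorphicOrderAt {f : ℂ → ℂ} (hf : Differentiable ℂ f) {z : ℂ} (h : f z = 0) :
    1 ≤ meromorphicOrderAt f z := by
  refine one_le_of_pos ((tendsto_zero_iff_meromorphicOrderAt_pos (hf.meromorphic z)).1 ?_)
  rw [← h]
  exact hf.continuous.continuousAt.tendsto.mono_left nhdsWithin_le_nhds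

lemma meromorphicOrderAt_eq_zero_of_ne_zero {f : ℂ → ℂ} (hf : Differentiable ℂ f) {z : ℂ}
    (h : f z ≠ 0) : meromorphicOrderAt f z = 0 := by
  refine (tendsto_ne_zero_iff_meromorphicOrderAt_eq_zero (hf.meromorphic z)).1 ⟨f z, h, ?_⟩
  exact hf.continuous.continuousAt.tendsto.mono_left nhdsWithin_le_nhds

lemma meromorphicOrderAt_comp_neg {f : ℂ → ℂ} (z : ℂ) :
    meromorphicOrderAt (fun w => f (-w)) z = meromorphicOrderAt f (-z) :=
  meromorphicOrderAt_comp_of_deriv_ne_zero (f := f) (g := fun w => -w) (by fun_prop)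
    (by rw [deriv_neg]; norm_num)

lemma meromorphicOrderAt_comp_add (f : ℂ → ℂ) (c z : ℂ) :
    meromorphicOrderAt (fun w => f (w + c)) z = meromorphicOrderAt f (z + c) := by
  exact meromorphicOrderAt_comp_add_const_eq_meromorphicOrderAt

lemma _root_.Meromorphic.comp_add {f : ℂ → ℂ} (hf : Meromorphic f) (c : ℂ) :
    Meromorphic fun z => f (z + c) :=
  Meromorphic.meromorphic_fun_comp_add_const_iff_meromorphic.2 hf

end Codiscrete

/-! ### Elliptic and double-Bloch functions with few poles -/

variable {L : PeriodPair}

/-- The codomain is arbitrary so that the lemma also covers the function `z ↦ meromorphicOrderAt f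
z`. -/
lemma periodic_of_periods {α : Type*} {f : ℂ → α} (h₁ : ∀ z, f (z + L.ω₁) = f z)
    (h₂ : ∀ z, f (z + L.ω₂) = f z) (z w : ℂ) (hw : w ∈ L.lattice) : f (z + w) = f z := by
  have key : ∀ w ∈ L.lattice, ∀ z, f (z + w) = f z := by
    intro w hw
    refine Submodule.span_induction (p := fun w _ => ∀ z, f (z + w) = f z) ?_ (by simp) ?_ ?_ hw
    · rintro x (rfl | rfl)
      exacts [h₁, h₂]
    · intro x y _ _ hx hy z
      rw [← add_assoc, hy, hx]
    · intro n x _ hx z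
      induction n using Int.induction_on generalizing z with
      | zero => simp
      | succ n ih => rw [add_smul, one_smul, ← add_assoc, hx, ih]
      | pred n ih =>
        rw [sub_smul, one_smul, ← hx, add_assoc, sub_add_cancel, ih]
  exact key w hw z

/-- Liouville's theorem for entire doubly periodic functions. -/
lemma eq_of_periodic {f : ℂ → ℂ} (hf : Differentiable ℂ f) (h₁ : ∀ z, f (z + L.ω₁) = f z)
    (h₂ : ∀ z, f (z + L.ω₂) = f z) (z w : ℂ) : f z = f w :=
  hf.apply_eq_apply_of_bounded (IsZLattice.isCompact_range_of_periodic L.lattice _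
    hf.continuous (periodic_of_periods h₁ h₂)).isBounded z w

lemma eq_zero_or_eq_zero_of_mul_eq_zero {f g : ℂ → ℂ} (hf : Differentiable ℂ f)
    (hg : Differentiable ℂ g) (h : ∀ z, f z * g z = 0) : f = 0 ∨ g = 0 := by
  have hc0 : Continuous (0 : ℂ → ℂ) := continuous_const
  rcases hf.meromorphic.eventuallyEq_zero_or_eventually_ne_zero with h1 | h1
  · exact Or.inl (eq_of_eventuallyEq_codiscrete hf.continuous hc0 h1)
  · refine Or.inr (eq_of_eventuallyEq_codiscrete hg.continuous hc0 ?_)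
    filter_upwards [h1] with z hz
    simpa [hz] using h z

/-- An entire function with Bloch multipliers and a zero vanishes. -/
lemma eq_zero_of_bloch {f : ℂ → ℂ} {B : ℂ × ℂ} (hf : Differentiable ℂ f)
    (h₁ : ∀ z, f (z + L.ω₁) = B.1 * f z) (h₂ : ∀ z, f (z + L.ω₂) = B.2 * f z)
    {p : ℂ} (hp : f p = 0) : f = 0 := by
  by_cases hB1 : B.1 = 0
  · funext z
    have := h₁ (z - L.ω₁)
    simpa [hB1] using this
  by_cases hB2 : B.2 = 0
  · funext z
    have := h₂ (z - L.ω₂)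
    simpa [hB2] using this
  have hd : Differentiable ℂ fun z => f (-z) := hf.comp differentiable_neg
  -- The multipliers of `f (-z)` are inverse to those of `f z`, so `f z * f (-z)` is entire and
  -- elliptic, hence constant, with value `0` at `p`.
  have hneg : ∀ (B w : ℂ), B ≠ 0 → (∀ z, f (z + w) = B * f z) →
      ∀ z, f (z + w) * f (-(z + w)) = f z * f (-z) := by
    intro B w hB h z
    have h' := h (-(z + w))
    rw [show -(z + w) + w = -z by ring] at h'
    rw [h, h']
    ring
  have hconst := eq_of_periodic (L := L) (hf.mul hd)
    (by simpa using hneg B.1 L.ω₁ hB1 h₁) (by simpa using hneg B.2 L.ω₂ hB2 h₂)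
  rcases eq_zero_or_eq_zero_of_mul_eq_zero hf hd fun z => by
    have := hconst z p
    simpa [hp] using this with h | h
  · exact h
  · funext z
    simpa using congrFun h (-z)

lemma IsDoubleBloch.exists_entire {f : ℂ → ℂ} {B : ℂ × ℂ} (hf : IsDoubleBloch L B f)
    (h : ∀ z, 0 ≤ meromorphicOrderAt f z) :
    ∃ g : ℂ → ℂ, Differentiable ℂ g ∧ f =ᶠ[codiscrete ℂ] g ∧
      (∀ z, g (z + L.ω₁) = B.1 * g z) ∧ ∀ z, g (z + L.ω₂) = B.2 * g z := by
  obtain ⟨g, hg, hfg⟩ := exists_differentiable_of_meromorphicOrderAt_nonneg hf.meromorphic h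
  have aux : ∀ B w : ℂ, ((fun z => f (z + w)) =ᶠ[codiscrete ℂ] fun z => B * f z) →
      ∀ z, g (z + w) = B * g z := by
    intro B w hw
    refine congrFun (eq_of_eventuallyEq_codiscrete
      (hg.continuous.comp (continuous_add_const w)) (continuous_const.mul hg.continuous) ?_)
    filter_upwards [hw, hfg, (tendsto_add_const_codiscrete w).eventually hfg] with z h1 h2 h3
    rw [← h2, ← h1, h3]
  exact ⟨g, hg, hfg, aux _ _ hf.bloch₁, aux _ _ hf.bloch₂⟩

/-- A double-Bloch function without poles and with a zero vanishes. -/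
lemma IsDoubleBloch.eq_zero {f : ℂ → ℂ} {B : ℂ × ℂ} (hf : IsDoubleBloch L B f)
    (h : ∀ z, 0 ≤ meromorphicOrderAt f z) {p : ℂ} (hp : 1 ≤ meromorphicOrderAt f p) :
    f =ᶠ[codiscrete ℂ] 0 := by
  obtain ⟨g, hg, hfg, h₁, h₂⟩ := hf.exists_entire h
  rw [meromorphicOrderAt_congr_codiscrete hfg] at hp
  rw [eq_zero_of_bloch hg h₁ h₂ (eq_zero_of_meromorphicOrderAt_pos hg hp)] at hfg
  exact hfg

lemma IsDoubleBloch.meromorphicOrderAt_add {f : ℂ → ℂ} {B : ℂ × ℂ} (hf : IsDoubleBloch L B f)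
    (h₁ : B.1 ≠ 0) (h₂ : B.2 ≠ 0) (z w : ℂ) (hw : w ∈ L.lattice) :
    meromorphicOrderAt f (z + w) = meromorphicOrderAt f z := by
  have aux : ∀ B w : ℂ, B ≠ 0 → ((fun z => f (z + w)) =ᶠ[codiscrete ℂ] fun z => B * f z) →
      ∀ z, meromorphicOrderAt f (z + w) = meromorphicOrderAt f z := by
    intro B w hB hw z
    rw [← meromorphicOrderAt_comp_add, meromorphicOrderAt_congr_codiscrete hw]
    exact meromorphicOrderAt_mul_of_ne_zero (g := fun _ => B) analyticAt_const hB
  exact periodic_of_periods (aux _ _ h₁ hf.bloch₁) (aux _ _ h₂ hf.bloch₂) z w hw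

lemma not_half_mem_lattice : (L.ω₁ / 2 + L.ω₂ / 2) ∉ L.lattice := by
  have := PeriodPair.mul_ω₁_add_mul_ω₂_mem_lattice (L := L) (α := 1 / 2) (β := 1 / 2)
  rw [show ((1 / 2 : ℚ) : ℂ) * L.ω₁ + ((1 / 2 : ℚ) : ℂ) * L.ω₂ = L.ω₁ / 2 + L.ω₂ / 2 by
    push_cast; ring] at this
  rw [this]
  rintro ⟨h, -⟩
  norm_num at h

/-- There is no elliptic function whose only singularities are simple poles at the lattice points. -/
lemma not_elliptic_of_order_neg_one {f : ℂ → ℂ} (hf : Meromorphic f)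
    (h₁ : ∀ z, f (z + L.ω₁) = f z) (h₂ : ∀ z, f (z + L.ω₂) = f z)
    (h0 : meromorphicOrderAt f 0 = -1) (hreg : ∀ z ∉ L.lattice, 0 ≤ meromorphicOrderAt f z) :
    False := by
  -- Antisymmetrization replaces the residue theorem: `g` keeps a simple pole at the origin and,
  -- being odd and periodic, must vanish at the half-periods outside the lattice.
  set g : ℂ → ℂ := fun z => f z - f (-z) with hg
  have hfn : Meromorphic fun z => f (-z) := fun z =>
    (hf (-z)).comp_analyticAt (g := fun w => -w) (by fun_prop)
  have hgm : Meromorphic g := hf.fun_sub hfn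
  have hper := periodic_of_periods h₁ h₂
  have hgper : ∀ z w, w ∈ L.lattice → g (z + w) = g z := by
    intro z w hw
    have : f (-(z + w)) = f (-z) := by
      rw [← hper (-(z + w)) w hw]; congr 1; ring
    simp only [hg, hper z w hw, this]
  have hgodd : ∀ z, g (-z) = -g z := fun z => by simp [hg]
  have hgord : ∀ z w, w ∈ L.lattice → meromorphicOrderAt g (z + w) = meromorphicOrderAt g z := by
    intro z w hw
    rw [← meromorphicOrderAt_comp_add]
    exact congrArg (meromorphicOrderAt · z) (funext fun z => hgper z w hw)
  have hgreg : ∀ z ∉ L.lattice, 0 ≤ meromorphicOrderAt g z := by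
    intro z hz
    have := meromorphicOrderAt_add (hf z) (hfn z).neg
    rw [← meromorphicOrderAt_neg (f := fun z => f (-z)), meromorphicOrderAt_comp_neg] at this
    have h3 := hreg (-z) (by simpa using hz)
    simp only [hg, sub_eq_add_neg]
    exact (le_min (hreg z hz) h3).trans this
  have hg0 : meromorphicOrderAt g 0 = -1 := by
    rw [show (-1 : WithTop ℤ) = ((-1 : ℤ) : WithTop ℤ) from rfl] at h0 ⊢
    rw [meromorphicOrderAt_eq_int_iff (hf 0)] at h0
    rw [meromorphicOrderAt_eq_int_iff (hgm 0)]
    obtain ⟨u, hu, hu0, hfu⟩ := h0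
    have hneg : AnalyticAt ℂ (fun z : ℂ => -z) 0 := by fun_prop
    refine ⟨fun z => u z + u (-z), hu.add (AnalyticAt.comp (f := fun z : ℂ => -z)
      (by simpa using hu) hneg), ?_, ?_⟩
    · simpa [← two_mul] using hu0
    · have ht : Tendsto (fun z : ℂ => -z) (𝓝[≠] 0) (𝓝[≠] 0) := by
        refine tendsto_nhdsWithin_iff.2 ⟨?_, ?_⟩
        · simpa using (continuous_neg.tendsto (0 : ℂ)).mono_left nhdsWithin_le_nhds
        · filter_upwards [self_mem_nhdsWithin] with w hw
          simpa using hw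
      filter_upwards [hfu, ht.eventually hfu, self_mem_nhdsWithin] with z h1 h2 h3
      have hz : z ≠ 0 := h3
      simp only [hg, h1, h2, sub_zero, zpow_neg_one, smul_eq_mul]
      field_simp
      ring
  have hhalf : ∀ w ∉ L.lattice, 2 * w ∈ L.lattice → 1 ≤ meromorphicOrderAt g w := by
    intro w hw hw2
    obtain ⟨c, hc⟩ := tendsto_nhds_of_meromorphicOrderAt_nonneg (hgm w) (hgreg w hw)
    -- Reflection in `w`: since `2 * w` is a period, `g (2 * w - z) = -g z`, so the limit of `g` at
    -- `w` is its own negative.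
    have ht : Tendsto (fun z : ℂ => 2 * w - z) (𝓝[≠] w) (𝓝[≠] w) := by
      refine tendsto_nhdsWithin_iff.2 ⟨?_, ?_⟩
      · have : Continuous fun z : ℂ => 2 * w - z := by fun_prop
        have := this.tendsto w
        rw [show 2 * w - w = w by ring] at this
        exact this.mono_left nhdsWithin_le_nhds
      · filter_upwards [self_mem_nhdsWithin] with z hz hz'
        refine hz ?_
        simp only [Set.mem_singleton_iff] at hz' ⊢
        linear_combination -hz'
    have h3 : Tendsto g (𝓝[≠] w) (𝓝 (-c)) := by
      refine ((hc.comp ht).neg).congr fun z => ?_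
      rw [Function.comp_apply, show 2 * w - z = -z + 2 * w by ring, hgper _ _ hw2, hgodd, neg_neg]
    have hc0 : c = 0 := self_eq_neg.1 (tendsto_nhds_unique hc h3)
    exact one_le_of_pos ((tendsto_zero_iff_meromorphicOrderAt_pos (hgm w)).1 (hc0 ▸ hc))
  have hw1 := L.ω₁_div_two_notMem_lattice
  have hw2 := L.ω₂_div_two_notMem_lattice
  have h2w1 : 2 * (L.ω₁ / 2) ∈ L.lattice := by
    rw [mul_div_cancel₀ _ two_ne_zero]; exact L.ω₁_mem_lattice
  have h2w2 : 2 * (L.ω₂ / 2) ∈ L.lattice := by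
    rw [mul_div_cancel₀ _ two_ne_zero]; exact L.ω₂_mem_lattice
  have hgs := hgm.comp_add (L.ω₁ / 2)
  -- The poles of each factor fall on zeros of the other, so `p` is pole-free; its zero at `ω₂ / 2`
  -- forces `p = 0`, which is incompatible with the pole of `g`.
  set p : ℂ → ℂ := fun z => g z * g (z + L.ω₁ / 2) with hp
  have hpord : ∀ z, meromorphicOrderAt p z =
      meromorphicOrderAt g z + meromorphicOrderAt g (z + L.ω₁ / 2) := by
    intro z
    rw [hp, fun_meromorphicOrderAt_mul (hgm z) (hgs z), meromorphicOrderAt_comp_add]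
  have hpb : IsDoubleBloch L (1, 1) p := by
    refine ⟨hgm.fun_mul hgs, .of_forall fun z => ?_, .of_forall fun z => ?_⟩
    · simp only [hp, one_mul]
      rw [hgper z _ L.ω₁_mem_lattice, add_right_comm, hgper _ _ L.ω₁_mem_lattice]
    · simp only [hp, one_mul]
      rw [hgper z _ L.ω₂_mem_lattice, add_right_comm, hgper _ _ L.ω₂_mem_lattice]
  have hlat : ∀ z ∈ L.lattice, meromorphicOrderAt g z = -1 := by
    intro z hz
    rw [← hg0, ← hgord 0 z hz, zero_add]
  have hp0 : p =ᶠ[codiscrete ℂ] 0 := by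
    refine hpb.eq_zero (p := L.ω₂ / 2) (fun z => ?_) ?_
    · rw [hpord]
      by_cases hz : z ∈ L.lattice
      · have h4 := hhalf (L.ω₁ / 2) hw1 h2w1
        rw [hlat z hz, add_comm z, hgord _ _ hz]
        exact le_trans (by norm_num) (add_le_add_right h4 (-1))
      · by_cases hz' : z + L.ω₁ / 2 ∈ L.lattice
        · have h5 : 2 * z ∈ L.lattice := by
            have := L.lattice.sub_mem (L.lattice.smul_mem (2 : ℤ) hz') L.ω₁_mem_lattice
            convert this using 1
            simp; ring
          rw [hlat _ hz']
          exact le_trans (by norm_num) (add_le_add_left (hhalf z hz h5) (-1))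
        · exact add_nonneg (hgreg z hz) (hgreg _ hz')
    · rw [hpord]
      refine le_trans (by norm_num) (add_le_add (hhalf _ hw2 h2w2) (hgreg _ ?_))
      rw [add_comm]
      exact not_half_mem_lattice
  have htop : meromorphicOrderAt p 0 = ⊤ :=
    meromorphicOrderAt_eq_top_iff.2 (hp0.filter_mono (nhdsNE_le_codiscrete 0))
  rw [hpord, hg0] at htop
  have h6 : meromorphicOrderAt g (0 + L.ω₁ / 2) = ⊤ := by
    rcases WithTop.add_eq_top.1 htop with h | h
    · exact absurd h (by decide)
    · exact h
  have h7 := meromorphicOrderAt_congr_codiscrete (meromorphicOrderAt_eq_top_of_exists hgm h6) 0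
  rw [hg0, meromorphicOrderAt_eq_top_iff.2 (by simp)] at h7
  exact absurd h7 (by decide)

variable (L) in
/-- The quasi-period of `sigma`. -/
def quasiPeriod (w : L.lattice) : ℂ := (exists_sigma_add_period L w).choose

variable (L) in
/-- The constant factor in the quasi-periodicity of `sigma`. -/
def sigmaFactor (w : L.lattice) : ℂ := (exists_sigma_add_period L w).choose_spec.choose

lemma sigmaFactor_ne_zero (w : L.lattice) : sigmaFactor L w ≠ 0 :=
  (exists_sigma_add_period L w).choose_spec.choose_spec.1

lemma sigma_add_period (w : L.lattice) (z : ℂ) :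
    sigma L (z + w) = sigmaFactor L w * Complex.exp (quasiPeriod L w * z) * sigma L z :=
  (exists_sigma_add_period L w).choose_spec.choose_spec.2 z

variable (L) in
/-- The period `ω₁` as an element of the lattice. -/
def period₁ : L.lattice := ⟨L.ω₁, L.ω₁_mem_lattice⟩

variable (L) in
/-- The period `ω₂` as an element of the lattice. -/
def period₂ : L.lattice := ⟨L.ω₂, L.ω₂_mem_lattice⟩

variable (L) in
/-- The Bloch multipliers of `sigma (z + v) / sigma z`. -/
def sigmaMultipliers (v : ℂ) : ℂ × ℂ :=
  (Complex.exp (quasiPeriod L (period₁ L) * v), Complex.exp (quasiPeriod L (period₂ L) * v))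

lemma meromorphicOrderAt_sigma {z : ℂ} (hz : z ∈ L.lattice) :
    meromorphicOrderAt (sigma L) z = 1 := by
  have h := sigma_add_period (L := L) ⟨z, hz⟩
  rw [← meromorphicOrderAt_sigma_zero L]
  have h2 := meromorphicOrderAt_comp_add (sigma L) z 0
  rw [zero_add] at h2
  rw [← h2, show (fun w => sigma L (w + z)) = _ from funext h]
  refine meromorphicOrderAt_mul_of_ne_zero (g := fun w => sigmaFactor L ⟨z, hz⟩ *
    Complex.exp (quasiPeriod L ⟨z, hz⟩ * w)) (by fun_prop) ?_
  exact mul_ne_zero (sigmaFactor_ne_zero _) (Complex.exp_ne_zero _)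

/-- There is no double-Bloch function without poles having the multipliers of
`sigma (z + v) / sigma z`, for `v` outside the lattice. -/
lemma IsDoubleBloch.eq_zero_of_sigmaMultipliers {f : ℂ → ℂ} {v : ℂ}
    (hf : IsDoubleBloch L (sigmaMultipliers L v) f) (hv : v ∉ L.lattice)
    (h : ∀ z, 0 ≤ meromorphicOrderAt f z) : f =ᶠ[codiscrete ℂ] 0 := by
  obtain ⟨g, hg, hfg, h₁, h₂⟩ := hf.exists_entire h
  by_cases hg0 : ∃ p, g p = 0
  · obtain ⟨p, hp⟩ := hg0
    rwa [eq_zero_of_bloch hg h₁ h₂ hp] at hfg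
  push Not at hg0
  -- If `g` had no zeros, `sigma (z + v) / (sigma z * g z)` would be elliptic with one simple pole
  -- modulo the lattice.
  exfalso
  have hn : Differentiable ℂ fun z => sigma L (z + v) := by fun_prop
  have hdg : Differentiable ℂ fun z => sigma L z * g z := by fun_prop
  have hper : ∀ (w : L.lattice), (∀ z, g (z + w) = Complex.exp (quasiPeriod L w * v) * g z) →
      ∀ z, sigma L (z + w + v) / (sigma L (z + w) * g (z + w)) =
        sigma L (z + v) / (sigma L z * g z) := by
    intro w hw z
    rw [add_right_comm, sigma_add_period, sigma_add_period, hw, mul_add, Complex.exp_add]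
    have h1 := sigmaFactor_ne_zero w
    have h2 := Complex.exp_ne_zero (quasiPeriod L w * z)
    have h3 := Complex.exp_ne_zero (quasiPeriod L w * v)
    rw [show sigmaFactor L w * (Complex.exp (quasiPeriod L w * z) *
      Complex.exp (quasiPeriod L w * v)) * sigma L (z + v) = (sigmaFactor L w *
      (Complex.exp (quasiPeriod L w * z) * Complex.exp (quasiPeriod L w * v))) *
      sigma L (z + v) by ring,
      show sigmaFactor L w * Complex.exp (quasiPeriod L w * z) * sigma L z *
      (Complex.exp (quasiPeriod L w * v) * g z) = (sigmaFactor L w *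
      (Complex.exp (quasiPeriod L w * z) * Complex.exp (quasiPeriod L w * v))) *
      (sigma L z * g z) by ring]
    exact mul_div_mul_left _ _ (mul_ne_zero h1 (mul_ne_zero h2 h3))
  have hord : ∀ z, meromorphicOrderAt (fun z => sigma L (z + v) / (sigma L z * g z)) z =
      meromorphicOrderAt (fun z => sigma L (z + v)) z - meromorphicOrderAt (sigma L) z := by
    intro z
    rw [fun_meromorphicOrderAt_div (hn.meromorphic z) (hdg.meromorphic z),
      fun_meromorphicOrderAt_mul ((differentiable_sigma L).meromorphic z) (hg.meromorphic z),
      meromorphicOrderAt_eq_zero_of_ne_zero hg (hg0 z), add_zero]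
  refine not_elliptic_of_order_neg_one (L := L)
    (f := fun z => sigma L (z + v) / (sigma L z * g z))
    (hn.meromorphic.fun_div hdg.meromorphic) (hper (period₁ L) h₁) (hper (period₂ L) h₂) ?_ ?_
  · rw [hord, meromorphicOrderAt_sigma_zero, meromorphicOrderAt_eq_zero_of_ne_zero hn
      (by simpa using sigma_ne_zero L hv)]
    rfl
  · intro z hz
    rw [hord, meromorphicOrderAt_eq_zero_of_ne_zero (differentiable_sigma L) (sigma_ne_zero L hz),
      sub_zero]
    exact (hn.analyticAt z).meromorphicOrderAt_nonneg

end DoubleBloch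
end

/-! ### Elliptic polynomials and necessity of the equations of motion -/

noncomputable section
namespace DoubleBloch
open scoped Topology

variable {L : PeriodPair} {N : ℕ}

lemma nonneg_of_one_le_add_one {a : WithTop ℤ} (h : 1 ≤ a + 1) : 0 ≤ a := by
  cases a with
  | top => exact le_top
  | coe n =>
    have h' : (1 : ℤ) ≤ n + 1 := by exact_mod_cast h
    have : (0 : ℤ) ≤ n := by linarith
    exact_mod_cast this

@[fun_prop]
lemma differentiable_ellipticPoly (a : Fin N → ℂ) : Differentiable ℂ (ellipticPoly L a) := by
  unfold ellipticPoly; fun_prop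

@[fun_prop]
lemma Differentiable.ellipticPoly (a : Fin N → ℂ) {f : ℂ → ℂ} (hf : Differentiable ℂ f) :
    Differentiable ℂ fun z => DoubleBloch.ellipticPoly L a (f z) :=
  (differentiable_ellipticPoly a).comp hf

lemma ellipticPoly_ne_zero {a : Fin N → ℂ} {z : ℂ} (h : ∀ i, z - a i ∉ L.lattice) :
    ellipticPoly L a z ≠ 0 :=
  Finset.prod_ne_zero_iff.2 fun i _ => sigma_ne_zero L (h i)

lemma ellipticPoly_eq_zero_iff {a : Fin N → ℂ} {z : ℂ} :
    ellipticPoly L a z = 0 ↔ z ∈ latticeTranslates L a := by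
  simp [ellipticPoly, Finset.prod_eq_zero_iff, sigma_eq_zero_iff, latticeTranslates]

lemma ellipticPoly_zero_self (a : Fin N → ℂ) (i : Fin N) : ellipticPoly L a (a i) = 0 :=
  ellipticPoly_eq_zero_iff.2 ⟨i, by simp⟩

lemma ellipticPoly_nontrivial (a : Fin N → ℂ) :
    ∀ᶠ z in codiscrete ℂ, ellipticPoly L a z ≠ 0 := by
  refine (differentiable_ellipticPoly a).meromorphic.eventuallyEq_zero_or_eventually_ne_zero.resolve_left
    fun h => ?_
  have h0 : ellipticPoly L a = 0 := eq_of_eventuallyEq_codiscrete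
    (differentiable_ellipticPoly a).continuous continuous_const h
  have hc : (latticeTranslates L a).Countable := by
    have : latticeTranslates L a = ⋃ i, (fun z => z - a i) ⁻¹' (L.lattice : Set ℂ) := by
      ext z; simp [latticeTranslates]
    rw [this]
    exact Set.countable_iUnion fun i => (countable_lattice L).preimage sub_left_injective
  refine not_countable_complex ?_
  refine hc.mono fun z _ => ?_
  rw [← ellipticPoly_eq_zero_iff, h0]
  rfl

/-- The points `a i` are pairwise different modulo the lattice. -/
def LatticeDistinct (L : PeriodPair) (a : Fin N → ℂ) : Prop :=
  ∀ i j, i ≠ j → a i - a j ∉ L.lattice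

lemma meromorphicOrderAt_ellipticPoly {a : Fin N → ℂ} (ha : LatticeDistinct L a) {z : ℂ}
    (hz : z ∈ latticeTranslates L a) : meromorphicOrderAt (ellipticPoly L a) z = 1 := by
  obtain ⟨i, hi⟩ := hz
  have hd : ∀ j, Differentiable ℂ fun z => sigma L (z - a j) := fun j => by fun_prop
  have h1 : ∀ j, meromorphicOrderAt (fun z => sigma L (z - a j)) z =
      if j = i then 1 else 0 := by
    intro j
    split_ifs with h
    · subst h
      have := meromorphicOrderAt_comp_add (sigma L) (-a j) z
      simp only [← sub_eq_add_neg] at this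
      rw [this, meromorphicOrderAt_sigma hi]
    · refine meromorphicOrderAt_eq_zero_of_ne_zero (hd j) (sigma_ne_zero L fun hj => ?_)
      refine ha j i h ?_
      have := L.lattice.sub_mem hi hj
      simpa using this
  unfold ellipticPoly
  rw [meromorphicOrderAt_fun_prod fun j _ => (hd j).meromorphic z]
  simp [h1]

/-- The definition of double-Bloch functions does not exclude zero multipliers; this disposes of
that degenerate case. -/
lemma IsDoubleBloch.eventuallyEq_zero_of_multiplier {f : ℂ → ℂ} {B : ℂ × ℂ}
    (hf : IsDoubleBloch L B f) (hB : B.1 = 0 ∨ B.2 = 0) : f =ᶠ[codiscrete ℂ] 0 := by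
  have aux : ∀ w : ℂ, ((fun z => f (z + w)) =ᶠ[codiscrete ℂ] fun _ => 0) →
      f =ᶠ[codiscrete ℂ] 0 := by
    intro w hw
    filter_upwards [(tendsto_add_const_codiscrete (-w)).eventually hw] with z hz
    simpa using hz
  rcases hB with h | h
  · exact aux L.ω₁ (by simpa [h] using hf.bloch₁)
  · exact aux L.ω₂ (by simpa [h] using hf.bloch₂)

lemma meromorphicOrderAt_add_of_mul_eq {f T H : ℂ → ℂ} (hf : Meromorphic f)
    (hT : Differentiable ℂ T) (h : (fun z => f z * T z) =ᶠ[codiscrete ℂ] H) (z : ℂ) :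
    meromorphicOrderAt f z + meromorphicOrderAt T z = meromorphicOrderAt H z := by
  rw [← meromorphicOrderAt_congr_codiscrete h, fun_meromorphicOrderAt_mul (hf z) (hT.meromorphic z)]

/-- A double-Bloch function `H / T` with `H`, `T` entire has no poles if `H` vanishes at the zeros
of `T` and these are simple; it suffices to check this modulo the lattice. -/
lemma IsDoubleBloch.meromorphicOrderAt_nonneg {f T H : ℂ → ℂ} {B : ℂ × ℂ}
    (hf : IsDoubleBloch L B f) (hB₁ : B.1 ≠ 0) (hB₂ : B.2 ≠ 0) (hT : Differentiable ℂ T)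
    (hH : Differentiable ℂ H) (h : (fun z => f z * T z) =ᶠ[codiscrete ℂ] H)
    (hz : ∀ z, T z = 0 → ∃ p, z - p ∈ L.lattice ∧ meromorphicOrderAt T p = 1 ∧ H p = 0) (z : ℂ) :
    0 ≤ meromorphicOrderAt f z := by
  have hadd := meromorphicOrderAt_add_of_mul_eq hf.meromorphic hT h
  by_cases hTz : T z = 0
  · obtain ⟨p, hp, hTp, hHp⟩ := hz z hTz
    rw [← add_sub_cancel p z, hf.meromorphicOrderAt_add hB₁ hB₂ p _ hp]
    refine nonneg_of_one_le_add_one ?_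
    rw [← hTp, hadd, hTp]
    exact one_le_meromorphicOrderAt hH hHp
  · have := hadd z
    rw [meromorphicOrderAt_eq_zero_of_ne_zero hT hTz, add_zero] at this
    rw [this]
    exact (hH.analyticAt z).meromorphicOrderAt_nonneg

section Generic

variable {η lam : ℂ} {x : ℤ → Fin N → ℂ}

lemma GenericPosition.latticeDistinct (hx : GenericPosition L η x) (m : ℤ) :
    LatticeDistinct L (x m) := fun i j hij => (hx.same_time m i j hij).1

lemma GenericPosition.poly_next_sub (hx : GenericPosition L η x) (m : ℤ) (j : Fin N) :
    ellipticPoly L (x (m + 1)) (x m j - η) ≠ 0 :=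
  ellipticPoly_ne_zero fun i h => (hx.next_time m j i).2 (by convert h using 1; ring)

lemma GenericPosition.poly_next (hx : GenericPosition L η x) (m : ℤ) (j : Fin N) :
    ellipticPoly L (x (m + 1)) (x m j) ≠ 0 :=
  ellipticPoly_ne_zero fun i h => (hx.next_time m j i).1 h

lemma GenericPosition.poly_same_sub (hx : GenericPosition L η x) (m : ℤ) (j : Fin N) :
    ellipticPoly L (x m) (x m j - η) ≠ 0 := by
  refine ellipticPoly_ne_zero fun i h => ?_
  by_cases hij : j = i
  · subst hij
    exact hx.step (by simpa using h)
  · exact (hx.same_time m j i hij).2 (by convert h using 1; ring)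

lemma GenericPosition.poly_same_add (hx : GenericPosition L η x) (m : ℤ) (j : Fin N) :
    ellipticPoly L (x m) (x m j + η) ≠ 0 := by
  refine ellipticPoly_ne_zero fun i h => ?_
  by_cases hij : i = j
  · subst hij
    exact hx.step (by simpa using h)
  · exact (hx.same_time m i j hij).2 (by convert L.lattice.neg_mem h using 1; ring)

lemma GenericPosition.poly_prev (hx : GenericPosition L η x) (m : ℤ) (j : Fin N) :
    ellipticPoly L (x m) (x (m + 1) j) ≠ 0 :=
  ellipticPoly_ne_zero fun i h =>
    (hx.next_time m i j).1 (by convert L.lattice.neg_mem h using 1; ring)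

lemma GenericPosition.poly_prev_add (hx : GenericPosition L η x) (m : ℤ) (j : Fin N) :
    ellipticPoly L (x m) (x (m + 1) j + η) ≠ 0 :=
  ellipticPoly_ne_zero fun i h =>
    (hx.next_time m i j).2 (by convert L.lattice.neg_mem h using 1; ring)

/-- Generic position makes the denominators non-zero. Time is shifted so that the middle index is `m
+ 1`, the time common to the steps from `m` to `m + 1` and from `m + 1` to `m + 2`. -/
lemma equationsOfMotion_iff (hx : GenericPosition L η x) :
    EquationsOfMotion L η x ↔ ∀ (m : ℤ) (j : Fin N),
      ellipticPoly L (x m) (x (m + 1) j) * ellipticPoly L (x (m + 1)) (x (m + 1) j + η) *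
        ellipticPoly L (x (m + 1 + 1)) (x (m + 1) j - η) =
      -(ellipticPoly L (x m) (x (m + 1) j + η) * ellipticPoly L (x (m + 1)) (x (m + 1) j - η) *
        ellipticPoly L (x (m + 1 + 1)) (x (m + 1) j)) := by
  have key : ∀ (m : ℤ) (j : Fin N),
      (∏ k, (sigma L (x (m + 1) j - x m k) * sigma L (x (m + 1) j - x (m + 1) k + η) *
          sigma L (x (m + 1) j - x (m + 1 + 1) k - η)) /
        (sigma L (x (m + 1) j - x m k + η) * sigma L (x (m + 1) j - x (m + 1) k - η) *
          sigma L (x (m + 1) j - x (m + 1 + 1) k)) = -1) ↔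
      ellipticPoly L (x m) (x (m + 1) j) * ellipticPoly L (x (m + 1)) (x (m + 1) j + η) *
        ellipticPoly L (x (m + 1 + 1)) (x (m + 1) j - η) =
      -(ellipticPoly L (x m) (x (m + 1) j + η) * ellipticPoly L (x (m + 1)) (x (m + 1) j - η) *
        ellipticPoly L (x (m + 1 + 1)) (x (m + 1) j)) := by
    intro m j
    rw [Finset.prod_div_distrib]
    simp only [Finset.prod_mul_distrib]
    have e : ∀ (a : Fin N → ℂ) z, ∏ k, sigma L (z - a k) = ellipticPoly L a z := fun _ _ => rfl
    simp only [sub_add_eq_add_sub, sub_right_comm _ _ η, e]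
    rw [div_eq_iff (mul_ne_zero (mul_ne_zero (hx.poly_prev_add m j) (hx.poly_same_sub (m + 1) j))
      (hx.poly_next (m + 1) j)), neg_one_mul]
  refine ⟨fun h m j => (key m j).1 ?_, fun h m j => ?_⟩
  · simpa using h (m + 1) j
  · have := (key (m - 1) j).2 (h (m - 1) j)
    simpa using this

/-- Entire functions `F m` such that `F m / τ^m` solves the linear problem with the shift
multiplied by `k`. -/
structure IsEntireSolution (L : PeriodPair) (η lam k : ℂ) (x : ℤ → Fin N → ℂ)
    (F : ℤ → ℂ → ℂ) : Prop where
  differentiable : ∀ m, Differentiable ℂ (F m)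
  equation : ∀ m z, k * F m (z + η) * ellipticPoly L (x (m + 1)) z -
    lam * F m z * ellipticPoly L (x (m + 1)) (z + η) = F (m + 1) z * ellipticPoly L (x m) (z + η)

namespace IsEntireSolution

variable {k : ℂ} {F : ℤ → ℂ → ℂ}

/-- The point `x m j - η` is a zero of `τ^m(z + η)`. The next two lemmas likewise use the zeros of
`τ^{m+1}(z)` and of `τ^{m+1}(z + η)`. -/
lemma at_pole (hF : IsEntireSolution L η lam k x F) (m : ℤ) (j : Fin N) :
    k * F m (x m j) * ellipticPoly L (x (m + 1)) (x m j - η) =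
      lam * F m (x m j - η) * ellipticPoly L (x (m + 1)) (x m j) := by
  have := hF.equation m (x m j - η)
  rw [sub_add_cancel, ellipticPoly_zero_self, mul_zero] at this
  exact sub_eq_zero.1 this

lemma at_next_pole (hF : IsEntireSolution L η lam k x F) (m : ℤ) (j : Fin N) :
    -(lam * F m (x (m + 1) j) * ellipticPoly L (x (m + 1)) (x (m + 1) j + η)) =
      F (m + 1) (x (m + 1) j) * ellipticPoly L (x m) (x (m + 1) j + η) := by
  have := hF.equation m (x (m + 1) j)
  rwa [ellipticPoly_zero_self, mul_zero, zero_sub] at this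

lemma at_next_pole_sub (hF : IsEntireSolution L η lam k x F) (m : ℤ) (j : Fin N) :
    k * F m (x (m + 1) j) * ellipticPoly L (x (m + 1)) (x (m + 1) j - η) =
      F (m + 1) (x (m + 1) j - η) * ellipticPoly L (x m) (x (m + 1) j) := by
  have := hF.equation m (x (m + 1) j - η)
  rwa [sub_add_cancel, ellipticPoly_zero_self, mul_zero, sub_zero] at this

/-- The relation `at_next_pole` has non-zero coefficients in generic position. It turns a non-zero
residue at time `m + 1` into the non-vanishing of `F m` needed for the elimination. -/
lemma ne_zero_iff (hF : IsEntireSolution L η lam k x F) (hlam : lam ≠ 0)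
    (hx : GenericPosition L η x) (m : ℤ) (j : Fin N) :
    F (m + 1) (x (m + 1) j) ≠ 0 ↔ F m (x (m + 1) j) ≠ 0 := by
  have h := hF.at_next_pole m j
  have h1 := hx.poly_same_add (m + 1) j
  have h2 := hx.poly_prev_add m j
  constructor
  · intro h3 h4
    rw [h4] at h
    simp [h2, h3] at h
  · intro h3 h4
    rw [h4] at h
    simp [h1, h3, hlam] at h

/-- The equation of motion at a pole with non-zero residue. -/
lemma equation_of_motion (hF : IsEntireSolution L η lam k x F) (hlam : lam ≠ 0) (hk : k ≠ 0)
    (m : ℤ) (j : Fin N) (h0 : F m (x (m + 1) j) ≠ 0) :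
    ellipticPoly L (x m) (x (m + 1) j) * ellipticPoly L (x (m + 1)) (x (m + 1) j + η) *
        ellipticPoly L (x (m + 1 + 1)) (x (m + 1) j - η) =
      -(ellipticPoly L (x m) (x (m + 1) j + η) * ellipticPoly L (x (m + 1)) (x (m + 1) j - η) *
        ellipticPoly L (x (m + 1 + 1)) (x (m + 1) j)) := by
  have h1 := hF.at_pole (m + 1) j
  have h2 := hF.at_next_pole m j
  have h3 := hF.at_next_pole_sub m j
  refine mul_left_cancel₀ (mul_ne_zero (mul_ne_zero hk hlam) h0) ?_
  set y := x (m + 1) j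
  -- The values of `F (m + 1)` at `y` and `y - η` are eliminated from the three relations.
  linear_combination (-ellipticPoly L (x m) (y + η) * ellipticPoly L (x m) y) * h1
    - k * ellipticPoly L (x m) y * ellipticPoly L (x (m + 1 + 1)) (y - η) * h2
    + lam * ellipticPoly L (x m) (y + η) * ellipticPoly L (x (m + 1 + 1)) y * h3

end IsEntireSolution

/-- Denominators can be cleared off a closed discrete set. Both sides being entire, the identity
extends to all points, in particular to the poles where it is later evaluated. -/
lemma LinearProblem.isEntireSolution {ψ : ℤ → ℂ → ℂ} {F : ℤ → ℂ → ℂ}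
    (hψ : LinearProblem L η lam x ψ) (hF : ∀ m, Differentiable ℂ (F m))
    (hFψ : ∀ m, (fun z => ψ m z * ellipticPoly L (x m) z) =ᶠ[codiscrete ℂ] F m) :
    IsEntireSolution L η lam 1 x F := by
  refine ⟨hF, fun m => ?_⟩
  have hFm := hF m
  have hFm1 := hF (m + 1)
  refine congrFun (eq_of_eventuallyEq_codiscrete (f := fun z => 1 * F m (z + η) *
    ellipticPoly L (x (m + 1)) z - lam * F m z * ellipticPoly L (x (m + 1)) (z + η))
    (g := fun z => F (m + 1) z * ellipticPoly L (x m) (z + η))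
    (Differentiable.continuous (𝕜 := ℂ) (by fun_prop))
    (Differentiable.continuous (𝕜 := ℂ) (by fun_prop)) ?_)
  have ht := tendsto_add_const_codiscrete η
  filter_upwards [hψ m, hFψ m, ht.eventually (hFψ m), hFψ (m + 1),
    ellipticPoly_nontrivial (L := L) (x (m + 1)),
    ht.eventually (ellipticPoly_nontrivial (L := L) (x m))] with z h1 h2 h3 h4 h5 h6
  rw [← h2, ← h3, ← h4, ← h1, coefficient]
  field_simp

lemma exists_entire_of_poles {f : ℂ → ℂ} {a : Fin N → ℂ} (hf : Meromorphic f)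
    (ha : LatticeDistinct L a) (h : AtMostSimplePoles (latticeTranslates L a) f) :
    ∃ F : ℂ → ℂ, Differentiable ℂ F ∧
      (fun z => f z * ellipticPoly L a z) =ᶠ[codiscrete ℂ] F := by
  have hd := differentiable_ellipticPoly (L := L) a
  refine exists_differentiable_of_meromorphicOrderAt_nonneg (hf.fun_mul hd.meromorphic) fun z => ?_
  rw [fun_meromorphicOrderAt_mul (hf z) (hd.meromorphic z)]
  by_cases hz : z ∈ latticeTranslates L a
  · rw [meromorphicOrderAt_ellipticPoly ha hz]
    exact le_trans (by norm_num) (add_le_add_left (h.2 z hz) 1)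
  · exact add_nonneg (h.1 z hz) (hd.analyticAt z).meromorphicOrderAt_nonneg

/-- Necessity of the equations of motion, for one solution with genuine poles. -/
lemma equationsOfMotion_of_simplePoles (hlam : lam ≠ 0) (hx : GenericPosition L η x)
    {ψ : Fin N → ℤ → ℂ → ℂ} (hψ : ∀ r, LinearProblem L η lam x (ψ r))
    (hmer : ∀ r m, Meromorphic (ψ r m))
    (hpole : ∀ r m, SimplePolesExactlyAt (latticeTranslates L (x m)) (ψ r m)) :
    EquationsOfMotion L η x := by
  rw [equationsOfMotion_iff hx]
  intro m j
  -- Any single solution would do; `j` itself serves as its label, so `N = 0` needs no separate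
  -- treatment.
  choose F hF hFψ using fun m => exists_entire_of_poles (hmer j m) (hx.latticeDistinct m)
    ⟨(hpole j m).1, fun z hz => ((hpole j m).2 z hz).ge⟩
  have hsol := (hψ j).isEntireSolution hF hFψ
  refine hsol.equation_of_motion hlam one_ne_zero m j ?_
  rw [← hsol.ne_zero_iff hlam hx]
  intro h0
  have hmem : x (m + 1) j ∈ latticeTranslates L (x (m + 1)) := ⟨j, by simp⟩
  have h1 := one_le_meromorphicOrderAt (hF (m + 1)) h0
  rw [← meromorphicOrderAt_add_of_mul_eq (hmer j (m + 1)) (differentiable_ellipticPoly _)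
    (hFψ (m + 1)), (hpole j (m + 1)).2 _ hmem,
    meromorphicOrderAt_ellipticPoly (hx.latticeDistinct _) hmem] at h1
  exact absurd h1 (by decide)

/-- Column `j` imposes no condition, so `N` coefficients are subject to at most `N - 1` linear
equations. -/
lemma exists_combination_vanishing (v : Fin N → Fin N → ℂ) (j : Fin N) (hj : ∀ r, v r j = 0) :
    ∃ c : Fin N → ℂ, c ≠ 0 ∧ ∀ i, ∑ r, c r * v r i = 0 := by
  have hM : (Matrix.of v).det = 0 := Matrix.det_eq_zero_of_column_eq_zero j hj
  obtain ⟨c, hc, h⟩ := Matrix.exists_vecMul_eq_zero_iff.2 hM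
  exact ⟨c, hc, fun i => by simpa [Matrix.vecMul, dotProduct] using congrFun h i⟩

lemma IsDoubleBloch.combination {B₀ : ℂ × ℂ} {b : Fin N → ℂ} {B : Fin N → ℂ × ℂ}
    {f : Fin N → ℂ → ℂ} (hB : ∀ r, B r = gauge L (b r) B₀)
    (hf : ∀ r, IsDoubleBloch L (B r) (f r)) (c : Fin N → ℂ) :
    IsDoubleBloch L B₀ fun z => ∑ r, c r * (Complex.exp (-(b r * z)) * f r z) := by
  have aux : ∀ (r : Fin N) (w B₀ : ℂ) (z : ℂ),
      f r (z + w) = B₀ * Complex.exp (b r * w) * f r z →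
      c r * (Complex.exp (-(b r * (z + w))) * f r (z + w)) =
        B₀ * (c r * (Complex.exp (-(b r * z)) * f r z)) := by
    intro r w B₀ z h
    rw [h, mul_add, neg_add, Complex.exp_add, Complex.exp_neg (b r * w)]
    have := Complex.exp_ne_zero (b r * w)
    field_simp
  refine ⟨Meromorphic.fun_sum fun r _ => (Meromorphic.const _).fun_mul
    (Meromorphic.fun_mul (Differentiable.meromorphic (by fun_prop)) (hf r).meromorphic), ?_, ?_⟩
  · filter_upwards [eventually_all.2 fun r => (hf r).bloch₁] with z hz
    rw [Finset.mul_sum]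
    refine Finset.sum_congr rfl fun r _ => aux r _ _ z ?_
    rw [hz r, hB r, gauge]
  · filter_upwards [eventually_all.2 fun r => (hf r).bloch₂] with z hz
    rw [Finset.mul_sum]
    refine Finset.sum_congr rfl fun r _ => aux r _ _ z ?_
    rw [hz r, hB r, gauge]

/-- Necessity of the equations of motion, for solutions independent after normalization. -/
lemma equationsOfMotion_of_normalizedIndependent (hlam : lam ≠ 0) (hx : GenericPosition L η x)
    {ψ : Fin N → ℤ → ℂ → ℂ} {B : Fin N → ℂ × ℂ} (hψ : IsSolutionSystem L η lam x ψ B)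
    (hpole : ∀ r m, AtMostSimplePoles (latticeTranslates L (x m)) (ψ r m))
    (hind : NormalizedIndependent L ψ B) : EquationsOfMotion L η x := by
  rw [equationsOfMotion_iff hx]
  intro m j
  obtain ⟨B₀, b, hB, hind⟩ := hind
  choose F hF hFψ using fun r m => exists_entire_of_poles (hψ.doubleBloch r m).meromorphic
    (hx.latticeDistinct m) (hpole r m)
  have hsol := fun r => (hψ.solves r).isEntireSolution (hF r) (hFψ r)
  by_contra hne
  have h0 : ∀ r, F r m (x (m + 1) j) = 0 := fun r => by
    by_contra h
    exact hne ((hsol r).equation_of_motion hlam one_ne_zero m j h)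
  have h1 : ∀ r, F r (m + 1) (x (m + 1) j) = 0 := fun r => by
    by_contra h
    exact ((hsol r).ne_zero_iff hlam hx m j).1 h (h0 r)
  -- Besides the missing residue, each solution acquires a zero at `x (m + 1) j - η`, where
  -- `τ^{m+1}` does not vanish.
  have h2 : ∀ r, F r (m + 1) (x (m + 1) j - η) = 0 := fun r => by
    have := (hsol r).at_next_pole_sub m j
    rw [h0 r] at this
    simpa [hx.poly_prev m j] using this
  -- The matrix of numerators at the poles at time `m + 1`, after normalization, has a zero column;
  -- the combination with coefficients `c` therefore has no poles at all.
  obtain ⟨c, hc, hci⟩ := exists_combination_vanishing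
    (fun r i => Complex.exp (-(b r * x (m + 1) i)) * F r (m + 1) (x (m + 1) i)) j
    (fun r => by simp [h1 r])
  refine hc (funext (hind (m + 1) c ?_))
  set G : ℂ → ℂ := fun z => ∑ r, c r * (Complex.exp (-(b r * z)) * ψ r (m + 1) z) with hG
  have hGb : IsDoubleBloch L B₀ G :=
    IsDoubleBloch.combination hB (fun r => hψ.doubleBloch r (m + 1)) c
  by_cases hB₁ : B₀.1 = 0
  · exact hGb.eventuallyEq_zero_of_multiplier (Or.inl hB₁)
  by_cases hB₂ : B₀.2 = 0
  · exact hGb.eventuallyEq_zero_of_multiplier (Or.inr hB₂)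
  set H : ℂ → ℂ := fun z => ∑ r, c r * (Complex.exp (-(b r * z)) * F r (m + 1) z) with hH
  have hHd : Differentiable ℂ H := by
    have := fun r => hF r (m + 1)
    fun_prop
  have hGH : (fun z => G z * ellipticPoly L (x (m + 1)) z) =ᶠ[codiscrete ℂ] H := by
    filter_upwards [eventually_all.2 fun r => hFψ r (m + 1)] with z hz
    simp only [hG, hH, Finset.sum_mul]
    exact Finset.sum_congr rfl fun r _ => by rw [← hz r]; ring
  refine hGb.eq_zero (p := x (m + 1) j - η) (hGb.meromorphicOrderAt_nonneg hB₁ hB₂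
    (differentiable_ellipticPoly _) hHd hGH fun z hz => ?_) ?_
  · obtain ⟨i, hi⟩ := ellipticPoly_eq_zero_iff.1 hz
    exact ⟨x (m + 1) i, hi, meromorphicOrderAt_ellipticPoly (hx.latticeDistinct _) ⟨i, by simp⟩,
      hci i⟩
  · have := meromorphicOrderAt_add_of_mul_eq hGb.meromorphic (differentiable_ellipticPoly _) hGH
      (x (m + 1) j - η)
    rw [meromorphicOrderAt_eq_zero_of_ne_zero (differentiable_ellipticPoly _)
      (hx.poly_same_sub (m + 1) j), add_zero] at this
    rw [this]
    exact one_le_meromorphicOrderAt hHd (by simp [hH, h2])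

end Generic

end DoubleBloch
end

noncomputable section
namespace DoubleBloch
open scoped Topology Polynomial

/-! ### Gauss's lemma for integer-valued valuations -/

section Gauss

variable {K : Type*} [Field K] (v : AddValuation K (WithTop ℤ))

/-- Taking the first index of least valuation gives the strict inequality that isolates a single
dominant term in a coefficient of a product. -/
lemma exists_first_minimal_coeff {Q : K[X]} (hQ : Q ≠ 0) :
    ∃ i, Q.coeff i ≠ 0 ∧ (∀ j, v (Q.coeff i) ≤ v (Q.coeff j)) ∧
      ∀ j < i, v (Q.coeff i) < v (Q.coeff j) := by
  classical
  obtain ⟨i₀, hi₀, hmin⟩ := Q.support.exists_min_image (fun i => v (Q.coeff i))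
    (Polynomial.support_nonempty.2 hQ)
  have hmin' : ∀ j, v (Q.coeff i₀) ≤ v (Q.coeff j) := by
    intro j
    by_cases hj : j ∈ Q.support
    · exact hmin j hj
    · rw [Polynomial.notMem_support_iff.1 hj, v.map_zero]; exact le_top
  have hex : ∃ i, v (Q.coeff i) = v (Q.coeff i₀) := ⟨i₀, rfl⟩
  have hspec := Nat.find_spec hex
  refine ⟨Nat.find hex, ?_, fun j => hspec.le.trans (hmin' j), fun j hj => ?_⟩
  · rw [← v.ne_top_iff, hspec, v.ne_top_iff]
    exact Polynomial.mem_support_iff.1 hi₀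
  · rw [hspec]
    exact lt_of_le_of_ne (hmin' j) fun h => Nat.find_min hex hj h.symm

lemma add_lt_add_of_le_of_lt_of_ne_top {a b c d : WithTop ℤ} (ha : a ≠ ⊤) (h1 : a ≤ c)
    (h2 : b < d) : a + b < c + d :=
  lt_of_lt_of_le (WithTop.add_lt_add_left ha h2) (by gcongr)

/-- Gauss's lemma for a valuation with values in the integers, for the product of two polynomials
one of whose coefficients is non-integral. -/
lemma exists_coeff_mul_lt {Q R : K[X]} {i j : ℕ} (hi : v (Q.coeff i) < 0) (hR : R ≠ 0) :
    ∃ n, v ((Q * R).coeff n) ≤ -1 + v (R.coeff j) := by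
  have hQ : Q ≠ 0 := by rintro rfl; simp at hi
  obtain ⟨a, ha0, ha1, ha2⟩ := exists_first_minimal_coeff v hQ
  obtain ⟨b, hb0, hb1, hb2⟩ := exists_first_minimal_coeff v hR
  have ha := (v.ne_top_iff).2 ha0
  have hb := (v.ne_top_iff).2 hb0
  -- Every other term of this coefficient has first index below `a` or second index below `b`, hence
  -- strictly larger valuation than the term `(a, b)`, so nothing cancels.
  refine ⟨a + b, ?_⟩
  have hmem : (a, b) ∈ Finset.HasAntidiagonal.antidiagonal (a + b) := by simp
  have hsum : (Q * R).coeff (a + b) = Q.coeff a * R.coeff b +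
      ∑ p ∈ (Finset.HasAntidiagonal.antidiagonal (a + b)).erase (a, b), Q.coeff p.1 * R.coeff p.2 := by
    rw [Polynomial.coeff_mul, Finset.add_sum_erase _ (fun p => Q.coeff p.1 * R.coeff p.2) hmem]
  have hlt : v (Q.coeff a * R.coeff b) <
      v (∑ p ∈ (Finset.HasAntidiagonal.antidiagonal (a + b)).erase (a, b), Q.coeff p.1 * R.coeff p.2) := by
    rw [v.map_mul]
    refine v.map_lt_sum (WithTop.add_ne_top.2 ⟨ha, hb⟩) fun p hp => ?_
    rw [v.map_mul]
    obtain ⟨hne, hp⟩ := Finset.mem_erase.1 hp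
    rw [Finset.HasAntidiagonal.mem_antidiagonal] at hp
    rcases lt_trichotomy p.1 a with h | h | h
    · rw [add_comm (v (Q.coeff a)), add_comm (v (Q.coeff p.1))]
      exact add_lt_add_of_le_of_lt_of_ne_top hb (hb1 _) (ha2 _ h)
    · exact absurd (Prod.ext h (by simp; omega)) hne
    · exact add_lt_add_of_le_of_lt_of_ne_top ha (ha1 _) (hb2 _ (by omega))
  rw [hsum, v.map_add_eq_of_lt_left hlt, v.map_mul]
  have h1 : v (Q.coeff a) ≤ -1 := by
    have h := (ha1 i).trans_lt hi
    cases hq : v (Q.coeff a) with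
    | top => exact absurd hq ha
    | coe n =>
      rw [hq] at h
      have h' : n < (0 : ℤ) := by exact_mod_cast h
      have : n ≤ (-1 : ℤ) := by omega
      exact WithTop.coe_le_coe.2 this
  exact add_le_add h1 (hb1 j)

/-- A monic factor of a monic polynomial with integral coefficients has integral coefficients. -/
lemma integral_of_monic_mul {Q R : K[X]} (hR : R.Monic)
    (h : ∀ n, 0 ≤ v ((Q * R).coeff n)) (i : ℕ) : 0 ≤ v (Q.coeff i) := by
  by_contra! hi
  obtain ⟨n, hn⟩ := exists_coeff_mul_lt v (j := R.natDegree) hi hR.ne_zero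
  rw [hR.coeff_natDegree, v.map_one, add_zero] at hn
  exact absurd ((h n).trans hn) (by decide)

/-- If the coefficients of a product have at most simple poles, one factor is integral. -/
lemma integral_or_integral_of_mul {Q R : K[X]} (hR : R ≠ 0) (h : ∀ n, -1 ≤ v ((Q * R).coeff n)) :
    (∀ i, 0 ≤ v (Q.coeff i)) ∨ ∀ i, 0 ≤ v (R.coeff i) := by
  by_contra! hc
  obtain ⟨⟨i, hi⟩, j, hj⟩ := hc
  obtain ⟨n, hn⟩ := exists_coeff_mul_lt v (j := j) hi hR
  have h1 := (h n).trans hn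
  cases hr : v (R.coeff j) with
  | top => rw [hr] at hj; exact absurd hj (by simp)
  | coe m =>
    rw [hr] at hj h1
    have hj' : m < (0 : ℤ) := by exact_mod_cast hj
    have h1' : (-1 : ℤ) ≤ -1 + m :=
      WithTop.coe_le_coe.1 (h1 : ((-1 : ℤ) : WithTop ℤ) ≤ ((-1 + m : ℤ) : WithTop ℤ))
    omega

end Gauss

/-! ### Factors of polynomials with a semilinear symmetry -/

section Twist

variable {K : Type*} [Field K] {T : K →+* K} {μ : K}

/-- A monic common factor inherits a semilinear symmetry. -/
lemma twisted_gcd {P S Q : K[X]} (hQ : Q.Monic) (hQP : Q ∣ P) (hQS : Q ∣ S)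
    {a b : K[X]} (hab : Q = a * P + b * S) (hP : P.map T = P.scaleRoots μ)
    (hS : S.map T = S.scaleRoots μ) : Q.map T = Q.scaleRoots μ := by
  -- Applying `T` to the Bézout identity expresses `Q.map T` through the rescaled `P` and `S`, both
  -- divisible by the rescaled `Q`. Equal degrees and monicity then give equality.
  have h1 : Q.scaleRoots μ ∣ Q.map T := by
    rw [hab, Polynomial.map_add, Polynomial.map_mul, Polynomial.map_mul, hP, hS, ← hab]
    exact dvd_add (Dvd.dvd.mul_left (Polynomial.scaleRoots_dvd _ _ hQP) _)
      (Dvd.dvd.mul_left (Polynomial.scaleRoots_dvd _ _ hQS) _)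
  exact (Polynomial.eq_of_monic_of_associated (hQ.map T) ((Polynomial.monic_scaleRoots_iff _).2 hQ)
    (Polynomial.associated_of_dvd_of_natDegree_le h1 (hQ.map T).ne_zero (by
      rw [hQ.natDegree_map, Polynomial.natDegree_scaleRoots])).symm)

lemma twisted_cofactor {P Q R : K[X]} (hP0 : P.Monic) (hPQ : P = Q * R)
    (hP : P.map T = P.scaleRoots μ) (hQ : Q.map T = Q.scaleRoots μ) :
    R.map T = R.scaleRoots μ := by
  have h : Q.map T * R.map T = Q.map T * R.scaleRoots μ := by
    rw [← Polynomial.map_mul, ← hPQ, hP, hQ, hPQ, Polynomial.mul_scaleRoots_of_noZeroDivisors]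
  refine mul_left_cancel₀ ?_ h
  rw [Polynomial.map_ne_zero_iff T.injective]
  rintro rfl
  exact hP0.ne_zero (by simpa using hPQ)

end Twist

/-! ### The field of meromorphic functions and twisted polynomials over it -/

section Field

/-- The ring of meromorphic functions on the plane, with arbitrary values at the singularities. -/
def meromorphicSubring : Subring (ℂ → ℂ) where
  carrier := {f | Meromorphic f}
  mul_mem' := Meromorphic.mul
  one_mem' := Meromorphic.const 1
  add_mem' := Meromorphic.add
  zero_mem' := Meromorphic.const 0
  neg_mem' := Meromorphic.neg

/-- The ideal of meromorphic functions vanishing off a closed discrete set. -/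
def vanishingIdeal : Ideal meromorphicSubring where
  carrier := {f | (f : ℂ → ℂ) =ᶠ[codiscrete ℂ] 0}
  add_mem' {f g} hf hg := by
    change _ =ᶠ[codiscrete ℂ] _ at hf hg ⊢
    filter_upwards [hf, hg] with z h1 h2
    simp [h1, h2]
  zero_mem' := EventuallyEq.refl (codiscrete ℂ) (0 : ℂ → ℂ)
  smul_mem' f g hg := by
    change _ =ᶠ[codiscrete ℂ] _ at hg ⊢
    filter_upwards [hg] with z h
    simp [h]

lemma mem_vanishingIdeal {f : meromorphicSubring} :
    f ∈ vanishingIdeal ↔ (f : ℂ → ℂ) =ᶠ[codiscrete ℂ] 0 := Iff.rfl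

instance : vanishingIdeal.IsMaximal := by
  refine Ideal.Quotient.maximal_of_isField _ ⟨⟨0, 1, ?_⟩, mul_comm, ?_⟩
  · intro h
    rw [eq_comm, ← map_one (Ideal.Quotient.mk _), Ideal.Quotient.eq_zero_iff_mem,
      mem_vanishingIdeal] at h
    obtain ⟨z, hz⟩ := h.exists
    exact one_ne_zero hz
  · intro a ha
    obtain ⟨f, rfl⟩ := Ideal.Quotient.mk_surjective a
    have hf : Meromorphic f.1 := f.2
    refine ⟨Ideal.Quotient.mk _ ⟨(f.1)⁻¹, hf.inv⟩, ?_⟩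
    rw [← map_mul, ← map_one (Ideal.Quotient.mk _), Ideal.Quotient.eq, mem_vanishingIdeal]
    rw [Ne, Ideal.Quotient.eq_zero_iff_mem, mem_vanishingIdeal] at ha
    filter_upwards [hf.eventuallyEq_zero_or_eventually_ne_zero.resolve_left ha] with z hz
    simp [hz]

/-- The field of meromorphic functions on the plane. -/
def MeromorphicField : Type := meromorphicSubring ⧸ vanishingIdeal

instance : Field MeromorphicField := Ideal.Quotient.field vanishingIdeal

/-- The class of a meromorphic function. -/
def toField : meromorphicSubring →+* MeromorphicField := Ideal.Quotient.mk vanishingIdeal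

lemma toField_surjective : Function.Surjective toField := Ideal.Quotient.mk_surjective

lemma toField_eq_zero_iff {f : meromorphicSubring} :
    toField f = 0 ↔ (f : ℂ → ℂ) =ᶠ[codiscrete ℂ] 0 := Ideal.Quotient.eq_zero_iff_mem

lemma toField_eq_iff {f g : meromorphicSubring} :
    toField f = toField g ↔ (f : ℂ → ℂ) =ᶠ[codiscrete ℂ] g := by
  rw [← sub_eq_zero, ← map_sub, toField_eq_zero_iff]
  refine ⟨fun h => ?_, fun h => ?_⟩
  · filter_upwards [h] with z hz
    exact sub_eq_zero.1 hz
  · filter_upwards [h] with z hz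
    exact sub_eq_zero.2 hz

/-- The order of vanishing at `p` as a valuation. -/
def orderValuation (p : ℂ) : AddValuation MeromorphicField (WithTop ℤ) :=
  AddValuation.of
    (fun a => meromorphicOrderAt (Function.surjInv toField_surjective a).1 p)
    (by
      refine meromorphicOrderAt_eq_top_iff.2 ?_
      exact (toField_eq_zero_iff.1 (Function.surjInv_eq toField_surjective 0)).filter_mono
        (nhdsNE_le_codiscrete p))
    (by
      have h := Function.surjInv_eq toField_surjective 1
      rw [← map_one toField, toField_eq_iff] at h
      rw [map_one] at h
      rw [meromorphicOrderAt_congr_codiscrete h]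
      exact meromorphicOrderAt_eq_zero_of_ne_zero (f := 1) (differentiable_const _) one_ne_zero)
    (fun a b => by
      have h := Function.surjInv_eq toField_surjective (a + b)
      nth_rewrite 2 [← Function.surjInv_eq toField_surjective a] at h
      nth_rewrite 2 [← Function.surjInv_eq toField_surjective b] at h
      rw [← map_add, toField_eq_iff] at h
      rw [meromorphicOrderAt_congr_codiscrete h]
      exact meromorphicOrderAt_add ((Function.surjInv toField_surjective a).2 p)
        ((Function.surjInv toField_surjective b).2 p))
    (fun a b => by
      have h := Function.surjInv_eq toField_surjective (a * b)
      nth_rewrite 2 [← Function.surjInv_eq toField_surjective a] at h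
      nth_rewrite 2 [← Function.surjInv_eq toField_surjective b] at h
      rw [← map_mul, toField_eq_iff] at h
      rw [meromorphicOrderAt_congr_codiscrete h]
      exact meromorphicOrderAt_mul ((Function.surjInv toField_surjective a).2 p)
        ((Function.surjInv toField_surjective b).2 p))

lemma orderValuation_toField (p : ℂ) (f : meromorphicSubring) :
    orderValuation p (toField f) = meromorphicOrderAt (f : ℂ → ℂ) p :=
  meromorphicOrderAt_congr_codiscrete (toField_eq_iff.1 (Function.surjInv_eq _ _)) p

/-- Translation of meromorphic functions. -/
def translate (w : ℂ) : meromorphicSubring →+* meromorphicSubring where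
  toFun f := ⟨fun z => f.1 (z + w), Meromorphic.comp_add f.2 w⟩
  map_one' := rfl
  map_mul' _ _ := rfl
  map_zero' := rfl
  map_add' _ _ := rfl

/-- Translation on the field of meromorphic functions. -/
def translateField (w : ℂ) : MeromorphicField →+* MeromorphicField :=
  Ideal.quotientMap vanishingIdeal (translate w) fun _ hf =>
    (tendsto_add_const_codiscrete w).eventually hf

lemma translateField_toField (w : ℂ) (f : meromorphicSubring) :
    translateField w (toField f) = toField (translate w f) := rfl

/-- Constant functions. -/
def constant : ℂ →+* meromorphicSubring where
  toFun c := ⟨fun _ => c, Meromorphic.const c⟩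
  map_one' := rfl
  map_mul' _ _ := rfl
  map_zero' := rfl
  map_add' _ _ := rfl

/-- Evaluation at a point. -/
def evalAt (u : ℂ) : meromorphicSubring →+* ℂ where
  toFun f := f.1 u
  map_one' := rfl
  map_mul' _ _ := rfl
  map_zero' := rfl
  map_add' _ _ := rfl

/-- Coprime polynomials over the field of meromorphic functions are coprime at almost all points. -/
lemma eventually_isCoprime {P S : meromorphicSubring[X]}
    (h : IsCoprime (P.map toField) (S.map toField)) :
    ∀ᶠ u in codiscrete ℂ, IsCoprime (P.map (evalAt u)) (S.map (evalAt u)) := by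
  obtain ⟨a, b, hab⟩ := h
  -- The Bézout coefficients lift to polynomials over actual functions; only finitely many
  -- coefficients must agree, so the identity can be evaluated off a closed discrete set.
  obtain ⟨a, rfl⟩ := Polynomial.map_surjective _ toField_surjective a
  obtain ⟨b, rfl⟩ := Polynomial.map_surjective _ toField_surjective b
  have h1 : (a * P + b * S - 1).map toField = 0 := by
    simp [hab]
  have h2 : ∀ n, ((a * P + b * S - 1).coeff n : ℂ → ℂ) =ᶠ[codiscrete ℂ] 0 := by
    intro n
    rw [← toField_eq_zero_iff, ← Polynomial.coeff_map, h1, Polynomial.coeff_zero]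
  have h3 : ∀ᶠ u in codiscrete ℂ, ∀ n ∈ (a * P + b * S - 1).support,
      ((a * P + b * S - 1).coeff n : ℂ → ℂ) u = 0 :=
    (eventually_all_finset _).2 fun n _ => h2 n
  filter_upwards [h3] with u hu
  refine ⟨a.map (evalAt u), b.map (evalAt u), ?_⟩
  have h4 : (a * P + b * S - 1).map (evalAt u) = 0 := by
    ext n
    rw [Polynomial.coeff_map, Polynomial.coeff_zero]
    by_cases hn : n ∈ (a * P + b * S - 1).support
    · exact hu n hn
    · rw [Polynomial.notMem_support_iff.1 hn, map_zero]
  rw [Polynomial.map_sub, Polynomial.map_add, Polynomial.map_mul, Polynomial.map_mul,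
    Polynomial.map_one] at h4
  exact sub_eq_zero.1 h4

variable {L : PeriodPair}

/-- `P` over the field of meromorphic functions satisfies
`P(μ k, u + ω) = μ ^ deg P * P(k, u)` for both periods, `μ` being the multipliers of
`sigma (u + v) / sigma u`. -/
structure IsTwisted (L : PeriodPair) (v : ℂ) (P : MeromorphicField[X]) : Prop where
  left : P.map (translateField L.ω₁) =
    P.scaleRoots (toField (constant (sigmaMultipliers L v).1))
  right : P.map (translateField L.ω₂) =
    P.scaleRoots (toField (constant (sigmaMultipliers L v).2))

lemma sigmaMultipliers_nat_mul (d : ℕ) (v : ℂ) :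
    sigmaMultipliers L (d * v) = ((sigmaMultipliers L v).1 ^ d, (sigmaMultipliers L v).2 ^ d) := by
  simp only [sigmaMultipliers, ← Complex.exp_nat_mul]
  congr 2 <;> ring

/-- The constant coefficient of a twisted monic polynomial with holomorphic coefficients
vanishes if its degree is not exceptional. -/
lemma IsTwisted.coeff_zero_eq_zero {v : ℂ} {Q : MeromorphicField[X]} (hQ : IsTwisted L v Q)
    (hd : (Q.natDegree : ℂ) * v ∉ L.lattice)
    (hreg : ∀ p ∉ L.lattice, 0 ≤ orderValuation p (Q.coeff 0))
    (h0 : 0 ≤ orderValuation 0 (Q.coeff 0)) : Q.coeff 0 = 0 := by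
  obtain ⟨f, hf⟩ := toField_surjective (Q.coeff 0)
  have aux : ∀ μ w : ℂ, Q.map (translateField w) = Q.scaleRoots (toField (constant μ)) →
      (fun z => f.1 (z + w)) =ᶠ[codiscrete ℂ] fun z => μ ^ Q.natDegree * f.1 z := by
    intro μ w h
    have h1 := congrArg (Polynomial.coeff · 0) h
    simp only [Polynomial.coeff_map, Polynomial.coeff_scaleRoots, ← hf, Nat.sub_zero] at h1
    rw [translateField_toField, ← map_pow, ← map_pow, ← map_mul, toField_eq_iff] at h1
    filter_upwards [h1] with z hz
    rw [mul_comm]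
    exact hz
  -- The constant coefficient is scaled by `μ ^ d`, where `d` is the degree; these are the
  -- multipliers belonging to `d * v`.
  have hb : IsDoubleBloch L (sigmaMultipliers L (Q.natDegree * v)) f.1 := by
    refine ⟨f.2, ?_, ?_⟩ <;> rw [sigmaMultipliers_nat_mul]
    · exact aux _ _ hQ.left
    · exact aux _ _ hQ.right
  rw [← hf] at hreg h0 ⊢
  simp only [orderValuation_toField] at hreg h0
  rw [toField_eq_zero_iff]
  refine hb.eq_zero_of_sigmaMultipliers hd fun z => ?_
  by_cases hz : z ∈ L.lattice
  · rw [← zero_add z, hb.meromorphicOrderAt_add (Complex.exp_ne_zero _) (Complex.exp_ne_zero _) 0 z hz]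
    exact h0
  · exact hreg z hz

/-- A twisted monic polynomial with at most simple poles at the lattice points and no others is
coprime to all twisted polynomials of smaller degree. -/
lemma IsTwisted.isCoprime {v : ℂ} {P S : MeromorphicField[X]} (hP : IsTwisted L v P)
    (hS : IsTwisted L v S) (hmonic : P.Monic) (hS0 : S ≠ 0) (hdeg : S.natDegree < P.natDegree)
    (hv : ∀ d : ℕ, 0 < d → d < P.natDegree → (d : ℂ) * v ∉ L.lattice)
    (hP0 : P.coeff 0 ≠ 0) (hreg : ∀ p ∉ L.lattice, ∀ n, 0 ≤ orderValuation p (P.coeff n))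
    (hlat : ∀ n, -1 ≤ orderValuation 0 (P.coeff n)) : IsCoprime P S := by
  classical
  by_contra hc
  set g := EuclideanDomain.gcd P S with hg
  have hg0 : g ≠ 0 := fun h => hS0 (EuclideanDomain.gcd_eq_zero_iff.1 h).2
  set Q := g * Polynomial.C g.leadingCoeff⁻¹ with hQdef
  have hl : g.leadingCoeff⁻¹ ≠ 0 := inv_ne_zero (Polynomial.leadingCoeff_ne_zero.2 hg0)
  have hQ : Q.Monic := Polynomial.monic_mul_leadingCoeff_inv hg0
  have hu : IsUnit (Polynomial.C g.leadingCoeff⁻¹) := Polynomial.isUnit_C.2 hl.isUnit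
  have hQP : Q ∣ P := (hu.mul_right_dvd).2 (EuclideanDomain.gcd_dvd_left P S)
  have hQS : Q ∣ S := (hu.mul_right_dvd).2 (EuclideanDomain.gcd_dvd_right P S)
  have hab : Q = (EuclideanDomain.gcdA P S * Polynomial.C g.leadingCoeff⁻¹) * P +
      (EuclideanDomain.gcdB P S * Polynomial.C g.leadingCoeff⁻¹) * S := by
    rw [hQdef]
    nth_rewrite 1 [hg]
    rw [EuclideanDomain.gcd_eq_gcd_ab]
    ring
  have hQd : 0 < Q.natDegree := by
    rw [Nat.pos_iff_ne_zero]
    intro h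
    have h1 : Q = 1 := (hQ.natDegree_eq_zero).1 h
    refine hc (EuclideanDomain.gcd_isUnit_iff.1
      (isUnit_of_mul_isUnit_left (y := Polynomial.C g.leadingCoeff⁻¹) ?_))
    rw [← hQdef, h1]
    exact isUnit_one
  have hQS' : Q.natDegree ≤ S.natDegree := Polynomial.natDegree_le_of_dvd hQS hS0
  obtain ⟨R, hPQ⟩ := hQP
  have hR : R.Monic := hQ.of_mul_monic_left (hPQ ▸ hmonic)
  have hdegs : P.natDegree = Q.natDegree + R.natDegree := by
    rw [hPQ, hQ.natDegree_mul hR]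
  have hQt : IsTwisted L v Q := ⟨
    twisted_gcd hQ ⟨R, hPQ⟩ hQS hab
      hP.left hS.left,
    twisted_gcd hQ ⟨R, hPQ⟩ hQS hab
      hP.right hS.right⟩
  have hRt : IsTwisted L v R := ⟨twisted_cofactor hmonic hPQ hP.left hQt.left,
    twisted_cofactor hmonic hPQ hP.right hQt.right⟩
  have hQreg : ∀ p ∉ L.lattice, ∀ n, 0 ≤ orderValuation p (Q.coeff n) := fun p hp =>
    integral_of_monic_mul _ hR (hPQ ▸ hreg p hp)
  have hRreg : ∀ p ∉ L.lattice, ∀ n, 0 ≤ orderValuation p (R.coeff n) := fun p hp =>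
    integral_of_monic_mul _ hQ (by rw [mul_comm, ← hPQ]; exact hreg p hp)
  have hmul : P.coeff 0 = Q.coeff 0 * R.coeff 0 := by rw [hPQ, Polynomial.mul_coeff_zero]
  -- Simple poles of `P` can be carried by one factor only. The other has a pole-free constant
  -- coefficient of non-exceptional degree, so it vanishes, and with it that of `P`.
  rcases integral_or_integral_of_mul (orderValuation 0) hR.ne_zero (hPQ ▸ hlat) with h | h
  · refine hP0 ?_
    rw [hmul, hQt.coeff_zero_eq_zero (hv _ hQd (by omega)) (fun p hp => hQreg p hp 0) (h 0),
      zero_mul]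
  · refine hP0 ?_
    rw [hmul, hRt.coeff_zero_eq_zero (hv _ (by omega) (by omega)) (fun p hp => hRreg p hp 0) (h 0),
      mul_zero]

end Field

end DoubleBloch
end

noncomputable section
namespace DoubleBloch
open scoped Topology Polynomial

/-! ### Characteristic polynomials under scaling, conjugation and rank-one poles -/

section Charpoly

variable {n : Type*} [Fintype n] [DecidableEq n]

lemma charpoly_smul {R : Type*} [CommRing R] [IsDomain R] (M : Matrix n n R) {μ : R} (hμ : μ ≠ 0) :
    (μ • M).charpoly = M.charpoly.scaleRoots μ := by
  have h : (μ • M).charpoly.comp (Polynomial.C μ * Polynomial.X) =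
      Polynomial.C μ ^ Fintype.card n * M.charpoly := by
    change Polynomial.compRingHom _ (Matrix.charmatrix (μ • M)).det = _
    rw [RingHom.map_det, Matrix.charpoly, ← Matrix.det_smul]
    congr 1
    ext1 i j
    by_cases hij : i = j
    · subst hij
      simp [mul_sub]
    · simp [hij]
  ext i
  have h1 := congrArg (Polynomial.coeff · i) h
  simp only [Polynomial.comp_C_mul_X_coeff, ← Polynomial.C_pow, Polynomial.coeff_C_mul] at h1
  refine mul_right_cancel₀ (pow_ne_zero i hμ) (h1.trans ?_)
  rw [Polynomial.coeff_scaleRoots, Matrix.charpoly_natDegree_eq_dim]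
  rcases le_or_gt i (Fintype.card n) with hi | hi
  · rw [mul_assoc, ← pow_add, Nat.sub_add_cancel hi, mul_comm]
  · rw [Polynomial.coeff_eq_zero_of_natDegree_lt (by rwa [Matrix.charpoly_natDegree_eq_dim])]
    simp

lemma charpoly_diagonal_conj {R : Type*} [CommRing R] [IsDomain R] (M : Matrix n n R) {μ : R}
    (hμ : μ ≠ 0) {a b : n → R} (hab : ∀ i, a i * b i = 1) :
    (Matrix.of fun i j => μ * (a i * M i j * b j)).charpoly = M.charpoly.scaleRoots μ := by
  have h : (Matrix.of fun i j => μ * (a i * M i j * b j)) =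
      Matrix.diagonal a * (μ • M) * Matrix.diagonal b := by
    ext i j
    simp [Matrix.mul_diagonal, Matrix.diagonal_mul]
    ring
  rw [h, Matrix.charpoly_mul_comm, ← mul_assoc, Matrix.diagonal_mul_diagonal,
    ← charpoly_smul M hμ]
  simp [mul_comm (b _), hab]

variable {K : Type*} [Field K] (v : AddValuation K (WithTop ℤ))

/-- The valuation ring of an additive valuation. -/
def valuationSubring : Subring K where
  carrier := {a | 0 ≤ v a}
  mul_mem' {a b} ha hb := by
    change 0 ≤ v (a * b)
    rw [v.map_mul]
    exact add_nonneg ha hb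
  one_mem' := v.map_one.ge
  add_mem' {a b} ha hb := (le_min ha hb).trans (v.map_add a b)
  zero_mem' := by
    change 0 ≤ v 0
    rw [v.map_zero]
    exact le_top
  neg_mem' {a} ha := by
    change 0 ≤ v (-a)
    rwa [v.map_neg]

variable {v}

lemma integral_charpoly {M : Matrix n n K} (h : ∀ i j, 0 ≤ v (M i j)) (k : ℕ) :
    0 ≤ v (M.charpoly.coeff k) := by
  have h1 : M = (Matrix.of fun i j => (⟨M i j, h i j⟩ : valuationSubring v)).map
      (valuationSubring v).subtype := rfl
  rw [h1, Matrix.charpoly_map, Polynomial.coeff_map]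
  exact ((Matrix.of fun i j => (⟨M i j, h i j⟩ : valuationSubring v)).charpoly.coeff k).2

/-- Schur complement of the corner entry. The border removes the possibly singular inverse `e` from
a rank-one perturbation, leaving only `d` in the matrix. -/
lemma det_bordered {R : Type*} [CommRing R] (A : Matrix n n R) (b c : n → R) {d e : R}
    (h : d * e = 1) :
    (Matrix.fromBlocks A (Matrix.of fun i _ => b i) (Matrix.of fun _ j => c j)
      (Matrix.diagonal fun _ : Unit => d)).det =
      d * (Matrix.of fun i j => A i j - b i * e * c j).det := by
  have hinv : Matrix.diagonal (fun _ : Unit => d) * Matrix.diagonal (fun _ => e) = 1 := by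
    rw [Matrix.diagonal_mul_diagonal, h, Matrix.diagonal_one]
  let inv : Invertible (Matrix.diagonal fun _ : Unit => d) :=
    ⟨_, mul_eq_one_comm.1 hinv, hinv⟩
  rw [Matrix.det_fromBlocks₂₂, invOf_eq_right_inv hinv, Matrix.det_diagonal]
  congr 1
  · simp
  · congr 1
    ext i j
    simp [Matrix.mul_apply]

/-- If the polar part of a matrix has rank one, its characteristic polynomial has at most the
pole of the matrix. -/
lemma integral_mul_charpoly {M : Matrix n n K} {ρ : n → K} {f : K} (hf : f ≠ 0)
    (hf' : 0 ≤ v f⁻¹) (hρ : ∀ i, 0 ≤ v (ρ i)) (h : ∀ i j, 0 ≤ v (M i j - ρ i * f)) (k : ℕ) :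
    0 ≤ v (f⁻¹ * M.charpoly.coeff k) := by
  let A : Matrix n n (valuationSubring v) := Matrix.of fun i j => ⟨M i j - ρ i * f, h i j⟩
  -- The Schur complement of the corner is `X - (M - ρ f) - ρ f = X - M`, so the determinant of this
  -- integral matrix is `f⁻¹` times the characteristic polynomial of `M`.
  let T : Matrix (n ⊕ Unit) (n ⊕ Unit) (valuationSubring v)[X] :=
    Matrix.fromBlocks A.charmatrix
      (Matrix.of fun i _ => Polynomial.C (⟨ρ i, hρ i⟩ : valuationSubring v))
      (Matrix.of fun _ _ => 1)
      (Matrix.diagonal fun _ => Polynomial.C (⟨f⁻¹, hf'⟩ : valuationSubring v))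
  have hT : T.det.map (valuationSubring v).subtype = Polynomial.C f⁻¹ * M.charpoly := by
    rw [← Polynomial.coe_mapRingHom, RingHom.map_det]
    have hC : Polynomial.C f⁻¹ * Polynomial.C f = 1 := by
      rw [← Polynomial.C_mul, inv_mul_cancel₀ hf, Polynomial.C_1]
    have hmap : (Polynomial.mapRingHom (valuationSubring v).subtype).mapMatrix T =
        Matrix.fromBlocks (Matrix.charmatrix (Matrix.of fun i j => M i j - ρ i * f))
          (Matrix.of fun i _ => Polynomial.C (ρ i)) (Matrix.of fun _ _ => 1)
          (Matrix.diagonal fun _ => Polynomial.C f⁻¹) := by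
      ext1 i j
      rcases i with i | i <;> rcases j with j | j
      · by_cases hij : i = j
        · subst hij
          simp [T, A]
        · simp [T, A, hij]
      · simp [T]
      · simp [T]
      · simp [T]
    rw [hmap, det_bordered _ _ _ hC, Matrix.charpoly]
    congr 2
    ext1 i j
    simp only [Matrix.of_apply, Matrix.charmatrix_apply, Polynomial.C_sub, Polynomial.C_mul]
    ring
  rw [← Polynomial.coeff_C_mul, ← hT, Polynomial.coeff_map]
  exact (T.det.coeff k).2

end Charpoly

/-! ### Lax matrices as functions of the spectral parameter -/

section Lax

variable {L : PeriodPair} {n : Type*}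

/-- The matrix with entries `w i j * sigma (s i - s j - η + u) / sigma u`. -/
def laxMatrix (L : PeriodPair) (η : ℂ) (s : n → ℂ) (w : n → n → ℂ) :
    Matrix n n meromorphicSubring :=
  Matrix.of fun i j => ⟨fun u => w i j * sigma L (s i - s j - η + u) / sigma L u,
    (Differentiable.meromorphic (by fun_prop)).fun_div (differentiable_sigma L).meromorphic⟩

variable {η : ℂ} {s : n → ℂ} {w : n → n → ℂ}

/-- The Lax matrix over the field of meromorphic functions. -/
def laxField (L : PeriodPair) (η : ℂ) (s : n → ℂ) (w : n → n → ℂ) :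
    Matrix n n MeromorphicField := (laxMatrix L η s w).map toField

/-- The entry acquires `exp (q (s i - s j - η))`, with `q` the quasi-period. The part depending on
`i` and `j` is a diagonal conjugation, invisible to the characteristic polynomial; only `exp (-q η)`
remains. -/
lemma laxMatrix_translate (l : L.lattice) (i j : n) :
    translate l (laxMatrix L η s w i j) =
      constant (Complex.exp (quasiPeriod L l * -η)) *
        (constant (Complex.exp (quasiPeriod L l * s i)) * laxMatrix L η s w i j *
          constant (Complex.exp (quasiPeriod L l * -s j))) := by
  refine Subtype.ext (funext fun u => ?_)
  change w i j * sigma L (s i - s j - η + (u + l)) / sigma L (u + l) =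
    Complex.exp (quasiPeriod L l * -η) * (Complex.exp (quasiPeriod L l * s i) *
      (w i j * sigma L (s i - s j - η + u) / sigma L u) * Complex.exp (quasiPeriod L l * -s j))
  rw [← add_assoc, sigma_add_period, sigma_add_period,
    show quasiPeriod L l * (s i - s j - η + u) = quasiPeriod L l * -η + quasiPeriod L l * s i +
      quasiPeriod L l * -s j + quasiPeriod L l * u by ring, Complex.exp_add, Complex.exp_add,
    Complex.exp_add]
  have h1 := sigmaFactor_ne_zero l
  have h2 := Complex.exp_ne_zero (quasiPeriod L l * u)
  by_cases hu : sigma L u = 0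
  · simp [hu]
  · field_simp

/-- The value of the Lax matrix at a point. -/
def laxAt (L : PeriodPair) (η : ℂ) (s : n → ℂ) (w : n → n → ℂ) (u : ℂ) : Matrix n n ℂ :=
  Matrix.of fun i j => w i j * sigma L (s i - s j - η + u) / sigma L u

lemma laxMatrix_map_evalAt (u : ℂ) : (laxMatrix L η s w).map (evalAt u) = laxAt L η s w u := rfl

lemma orderValuation_laxField_nonneg {p : ℂ} (hp : p ∉ L.lattice) (i j : n) :
    0 ≤ orderValuation p (laxField L η s w i j) := by
  rw [laxField, Matrix.map_apply, orderValuation_toField]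
  have hd : DifferentiableOn ℂ (laxMatrix L η s w i j).1 (L.lattice : Set ℂ)ᶜ := by
    intro z hz
    refine DifferentiableAt.differentiableWithinAt ?_
    change DifferentiableAt ℂ (fun u => w i j * sigma L (s i - s j - η + u) / sigma L u) z
    refine DifferentiableAt.div ?_ (differentiable_sigma L z) (sigma_ne_zero L hz)
    have : Differentiable ℂ fun u => w i j * sigma L (s i - s j - η + u) := by fun_prop
    exact this z
  exact (hd.analyticAt ((isOpen_compl_lattice L).mem_nhds hp)).meromorphicOrderAt_nonneg

variable [Fintype n] [DecidableEq n]

lemma isTwisted_charpoly : IsTwisted L (-η) (laxField L η s w).charpoly := by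
  have key : ∀ l : L.lattice, (laxField L η s w).charpoly.map (translateField l) =
      (laxField L η s w).charpoly.scaleRoots
        (toField (constant (Complex.exp (quasiPeriod L l * -η)))) := by
    intro l
    have hμ : toField (constant (Complex.exp (quasiPeriod L l * -η))) ≠ 0 :=
      (map_ne_zero (toField.comp constant)).2 (Complex.exp_ne_zero _)
    rw [← Matrix.charpoly_map, ← charpoly_diagonal_conj (laxField L η s w) hμ
      (a := fun i => toField (constant (Complex.exp (quasiPeriod L l * s i))))
      (b := fun i => toField (constant (Complex.exp (quasiPeriod L l * -s i))))]
    · congr 1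
      ext1 i j
      simp only [Matrix.map_apply, laxField, Matrix.of_apply, translateField_toField,
        laxMatrix_translate, map_mul]
    · intro i
      rw [← map_mul, ← map_mul, ← Complex.exp_add]
      simp
  exact ⟨key (period₁ L), key (period₂ L)⟩

instance : CharZero MeromorphicField :=
  charZero_of_injective_ringHom (toField.comp constant).injective

lemma IsTwisted.derivative {v : ℂ} {P : MeromorphicField[X]} (hP : IsTwisted L v P) :
    IsTwisted L v P.derivative := by
  have key : ∀ (T : MeromorphicField →+* MeromorphicField) μ, P.map T = P.scaleRoots μ →
      P.derivative.map T = P.derivative.scaleRoots μ := by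
    intro T μ h
    rw [← Polynomial.derivative_map, h]
    ext i
    rw [Polynomial.coeff_derivative, Polynomial.coeff_scaleRoots, Polynomial.coeff_scaleRoots,
      Polynomial.coeff_derivative, Polynomial.natDegree_derivative, Nat.sub_sub, add_comm 1 i]
    ring
  exact ⟨key _ _ hP.left, key _ _ hP.right⟩

/-- By `hw` the polar part of the entry `(i, j)` at `u = 0` is `ρ i / sigma u`, independent of `j`.
This rank-one structure bounds the pole order by one, whatever the size of the matrix. -/
lemma orderValuation_charpoly (hw : ∃ ρ : n → ℂ, ∀ i j, w i j * sigma L (s i - s j - η) = ρ i)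
    (k : ℕ) : -1 ≤ orderValuation 0 ((laxField L η s w).charpoly.coeff k) := by
  obtain ⟨ρ, hρ⟩ := hw
  have hmer := (differentiable_sigma L).meromorphic
  let g : meromorphicSubring := ⟨sigma L, hmer⟩
  have hg : orderValuation 0 (toField g) = 1 :=
    (orderValuation_toField _ _).trans (meromorphicOrderAt_sigma_zero L)
  have hg0 : toField g ≠ 0 := by
    rw [← (orderValuation 0).ne_top_iff, hg]
    decide
  have h := integral_mul_charpoly (v := orderValuation 0) (M := laxField L η s w)
    (f := (toField g)⁻¹) (ρ := fun i => toField (constant (ρ i))) (inv_ne_zero hg0)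
    (by rw [inv_inv, hg]; decide) (fun i => by
      rw [orderValuation_toField]
      exact (analyticAt_const (v := ρ i)).meromorphicOrderAt_nonneg) (fun i j => by
      have hd : Differentiable ℂ fun u => w i j * sigma L (s i - s j - η + u) - ρ i := by fun_prop
      have h1 : laxField L η s w i j - toField (constant (ρ i)) * (toField g)⁻¹ =
          toField ⟨_, hd.meromorphic⟩ * (toField g)⁻¹ := by
        rw [eq_mul_inv_iff_mul_eq₀ hg0, sub_mul, mul_assoc, inv_mul_cancel₀ hg0, mul_one,
          laxField, Matrix.map_apply, ← map_mul, ← map_sub, toField_eq_iff]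
        filter_upwards [hmer.eventuallyEq_zero_or_eventually_ne_zero.resolve_left fun h =>
          hg0 (toField_eq_zero_iff.2 h)] with u hu
        change w i j * sigma L (s i - s j - η + u) / sigma L u * sigma L u - ρ i = _
        rw [div_mul_cancel₀ _ hu]
      have h2 : 1 ≤ orderValuation 0 (toField ⟨_, hd.meromorphic⟩) := by
        rw [orderValuation_toField]
        refine one_le_meromorphicOrderAt hd ?_
        simp [hρ]
      rw [h1]
      have h3 := (orderValuation 0).map_mul (toField ⟨_, hd.meromorphic⟩ * (toField g)⁻¹) (toField g)
      rw [mul_assoc, inv_mul_cancel₀ hg0, mul_one, hg] at h3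
      rw [h3] at h2
      exact nonneg_of_one_le_add_one h2) k
  rw [inv_inv, AddValuation.map_mul, hg] at h
  revert h
  cases orderValuation 0 ((laxField L η s w).charpoly.coeff k) with
  | top => intro; exact le_top
  | coe a =>
    intro h
    have h' : (0 : ℤ) ≤ 1 + a := WithTop.coe_le_coe.1 (h : ((0 : ℤ) : WithTop ℤ) ≤ ((1 + a : ℤ) : WithTop ℤ))
    have : (-1 : ℤ) ≤ a := by omega
    exact WithTop.coe_le_coe.2 this

/-- The constant coefficient is the determinant up to sign, so it is non-zero as a meromorphic
function of `u`. -/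
lemma isCoprime_charpoly (hw : ∃ ρ : n → ℂ, ∀ i j, w i j * sigma L (s i - s j - η) = ρ i)
    (hη : ∀ d : ℕ, 0 < d → d < Fintype.card n → (d : ℂ) * η ∉ L.lattice)
    (hdet : ∀ᶠ u in codiscrete ℂ, (laxAt L η s w u).det ≠ 0) {S : MeromorphicField[X]}
    (hS : IsTwisted L (-η) S) (hS0 : S ≠ 0) (hdeg : S.natDegree < Fintype.card n) :
    IsCoprime (laxField L η s w).charpoly S := by
  refine isTwisted_charpoly.isCoprime hS (Matrix.charpoly_monic _) hS0 ?_ ?_ ?_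
    (fun p hp => integral_charpoly (orderValuation_laxField_nonneg hp))
    (orderValuation_charpoly hw)
  · rwa [Matrix.charpoly_natDegree_eq_dim]
  · intro d h0 h1 h2
    rw [Matrix.charpoly_natDegree_eq_dim] at h1
    exact hη d h0 h1 (by convert L.lattice.neg_mem h2 using 1; ring)
  · intro h
    have h1 := Matrix.det_eq_sign_charpoly_coeff (laxField L η s w)
    rw [h, mul_zero, laxField, ← RingHom.mapMatrix_apply, ← RingHom.map_det,
      toField_eq_zero_iff] at h1
    obtain ⟨u, hu1, hu2⟩ := (h1.and hdet).exists
    refine hu2 ?_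
    rw [← laxMatrix_map_evalAt, ← RingHom.mapMatrix_apply, ← RingHom.map_det]
    exact hu1

lemma eventually_charpoly_separable [Nonempty n]
    (hw : ∃ ρ : n → ℂ, ∀ i j, w i j * sigma L (s i - s j - η) = ρ i)
    (hη : ∀ d : ℕ, 0 < d → d < Fintype.card n → (d : ℂ) * η ∉ L.lattice)
    (hdet : ∀ᶠ u in codiscrete ℂ, (laxAt L η s w u).det ≠ 0) :
    ∀ᶠ u in codiscrete ℂ, (laxAt L η s w u).charpoly.Separable := by
  have hpos : 0 < Fintype.card n := Fintype.card_pos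
  have hd : (laxField L η s w).charpoly.derivative.natDegree = Fintype.card n - 1 := by
    rw [Polynomial.natDegree_derivative, Matrix.charpoly_natDegree_eq_dim]
  have hd0 : (laxField L η s w).charpoly.derivative ≠ 0 := fun h => by
    have := Polynomial.derivative_eq_zero.1 h
    rw [Matrix.charpoly_natDegree_eq_dim] at this
    omega
  have h := isCoprime_charpoly hw hη hdet isTwisted_charpoly.derivative hd0 (by omega)
  rw [laxField, Matrix.charpoly_map, Polynomial.derivative_map] at h
  filter_upwards [eventually_isCoprime h] with u hu
  rwa [← Polynomial.derivative_map, ← Matrix.charpoly_map] at hu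

/-- A principal submatrix is a Lax matrix with the same `η`, so its characteristic polynomial is
twisted in the same way and has smaller degree. -/
lemma eventually_charpoly_isCoprime_minor
    (hw : ∃ ρ : n → ℂ, ∀ i j, w i j * sigma L (s i - s j - η) = ρ i)
    (hη : ∀ d : ℕ, 0 < d → d < Fintype.card n → (d : ℂ) * η ∉ L.lattice)
    (hdet : ∀ᶠ u in codiscrete ℂ, (laxAt L η s w u).det ≠ 0) (i : n) :
    ∀ᶠ u in codiscrete ℂ, IsCoprime (laxAt L η s w u).charpoly
      ((laxAt L η s w u).submatrix (Subtype.val : {j // j ≠ i} → n) Subtype.val).charpoly := by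
  have h := isCoprime_charpoly hw hη hdet
    (S := (laxField L η (fun j : {j // j ≠ i} => s j) fun j k => w j k).charpoly)
    isTwisted_charpoly (Matrix.charpoly_monic _).ne_zero (by
      rw [Matrix.charpoly_natDegree_eq_dim]
      exact Fintype.card_subtype_lt (x := i) (by simp))
  rw [laxField, laxField, Matrix.charpoly_map, Matrix.charpoly_map] at h
  filter_upwards [eventually_isCoprime h] with u hu
  rwa [← Matrix.charpoly_map, ← Matrix.charpoly_map] at hu

end Lax

end DoubleBloch
end

/-! ### Theta functions with prescribed zeros -/

noncomputable section
namespace DoubleBloch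
open scoped Topology

variable {L : PeriodPair} {N : ℕ}

/-- Theta functions of degree `d`: the entire functions with the quasi-periodicity of
`∏ sigma (z - a i)` for `d` points with sum `α`. -/
structure IsTheta (L : PeriodPair) (d : ℕ) (α : ℂ) (H : ℂ → ℂ) : Prop where
  differentiable : Differentiable ℂ H
  add_period : ∀ (l : L.lattice) (z : ℂ), H (z + l) =
    sigmaFactor L l ^ d * Complex.exp (quasiPeriod L l * (d * z - α)) * H z

namespace IsTheta

variable {d e : ℕ} {α β : ℂ} {H G : ℂ → ℂ}

lemma mul (hH : IsTheta L d α H) (hG : IsTheta L e β G) :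
    IsTheta L (d + e) (α + β) fun z => H z * G z := by
  refine ⟨hH.differentiable.mul hG.differentiable, fun l z => ?_⟩
  rw [hH.add_period, hG.add_period, pow_add, show quasiPeriod L l * (((d + e : ℕ) : ℂ) * z -
    (α + β)) = quasiPeriod L l * (d * z - α) + quasiPeriod L l * (e * z - β) by
      push_cast; ring, Complex.exp_add]
  ring

lemma comp_add (hH : IsTheta L d α H) (c : ℂ) : IsTheta L d (α - d * c) fun z => H (z + c) := by
  refine ⟨hH.differentiable.comp (differentiable_id.add_const c), fun l z => ?_⟩
  rw [add_right_comm, hH.add_period]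
  congr 3
  ring

lemma const_mul (hH : IsTheta L d α H) (c : ℂ) : IsTheta L d α fun z => c * H z := by
  refine ⟨hH.differentiable.const_mul c, fun l z => ?_⟩
  rw [hH.add_period]
  ring

lemma sub (hH : IsTheta L d α H) (hG : IsTheta L d α G) : IsTheta L d α fun z => H z - G z := by
  refine ⟨hH.differentiable.sub hG.differentiable, fun l z => ?_⟩
  rw [hH.add_period, hG.add_period]
  ring

lemma sum {ι : Type*} [Fintype ι] {H : ι → ℂ → ℂ} (h : ∀ i, IsTheta L d α (H i)) :
    IsTheta L d α fun z => ∑ i, H i z := by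
  refine ⟨Differentiable.fun_sum fun i _ => (h i).differentiable, fun l z => ?_⟩
  rw [Finset.mul_sum]
  exact Finset.sum_congr rfl fun i _ => (h i).add_period l z

lemma congr (hH : IsTheta L d α H) (he : d = e) (hβ : α = β) : IsTheta L e β H := by
  subst he hβ
  exact hH

lemma ellipticPoly (a : Fin N → ℂ) : IsTheta L N (∑ i, a i) (ellipticPoly L a) := by
  refine ⟨differentiable_ellipticPoly a, fun l z => ?_⟩
  simp only [DoubleBloch.ellipticPoly, add_sub_right_comm, sigma_add_period]
  rw [Finset.prod_mul_distrib, Finset.prod_mul_distrib, ← Complex.exp_sum, ← Finset.mul_sum]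
  simp

/-- The quotient of a theta function by an elliptic polynomial is double-Bloch. -/
lemma isDoubleBloch_div {a : Fin N → ℂ} (hH : IsTheta L N α H) :
    IsDoubleBloch L (sigmaMultipliers L (∑ i, a i - α))
      fun z => H z / DoubleBloch.ellipticPoly L a z := by
  have key : ∀ (l : L.lattice) (z : ℂ), H (z + l) / DoubleBloch.ellipticPoly L a (z + l) =
      Complex.exp (quasiPeriod L l * (∑ i, a i - α)) *
        (H z / DoubleBloch.ellipticPoly L a z) := by
    intro l z
    have h1 := pow_ne_zero N (sigmaFactor_ne_zero l)
    have h2 := Complex.exp_ne_zero (quasiPeriod L l * (N * z - ∑ i, a i))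
    rw [hH.add_period, (ellipticPoly a).add_period,
      show quasiPeriod L l * (N * z - α) = quasiPeriod L l * (∑ i, a i - α) +
        quasiPeriod L l * (N * z - ∑ i, a i) by ring, Complex.exp_add]
    by_cases hz : DoubleBloch.ellipticPoly L a z = 0
    · simp [hz]
    · field_simp
  exact ⟨hH.differentiable.meromorphic.fun_div (differentiable_ellipticPoly a).meromorphic,
    .of_eq (funext (key (period₁ L))), .of_eq (funext (key (period₂ L)))⟩

/-- A theta function of degree `N` with `N` prescribed zeros vanishes, unless the sum of these is
congruent to that of its zeros. -/
lemma eq_zero {b : Fin N → ℂ} (hH : IsTheta L N α H) (hb : LatticeDistinct L b)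
    (h : ∀ i, H (b i) = 0) (hα : ∑ i, b i - α ∉ L.lattice) : H = 0 := by
  have hf := hH.isDoubleBloch_div (a := b)
  have hT := differentiable_ellipticPoly (L := L) b
  have hmul : (fun z => H z / DoubleBloch.ellipticPoly L b z * DoubleBloch.ellipticPoly L b z)
      =ᶠ[codiscrete ℂ] H := by
    filter_upwards [ellipticPoly_nontrivial b] with z hz
    rw [div_mul_cancel₀ _ hz]
  -- Division by the elliptic polynomial with zeros `b` gives a pole-free function whose multipliers
  -- belong to `∑ b i - α`, a number outside the lattice.
  have h0 := hf.eq_zero_of_sigmaMultipliers hα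
    (hf.meromorphicOrderAt_nonneg (Complex.exp_ne_zero _) (Complex.exp_ne_zero _) hT
      hH.differentiable hmul fun z hz => by
        obtain ⟨i, hi⟩ := ellipticPoly_eq_zero_iff.1 hz
        exact ⟨b i, hi, meromorphicOrderAt_ellipticPoly hb ⟨i, by simp⟩, h i⟩)
  refine eq_of_eventuallyEq_codiscrete hH.differentiable.continuous continuous_const ?_
  filter_upwards [hmul, h0] with z h1 h2
  rw [← h1, h2]
  simp

end IsTheta

lemma ellipticPoly_update (a : Fin N → ℂ) (j : Fin N) (b z : ℂ) :
    ellipticPoly L (Function.update a j b) z =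
      sigma L (z - b) * ∏ l ∈ Finset.univ.erase j, sigma L (z - a l) := by
  rw [ellipticPoly, ← Finset.mul_prod_erase _ _ (Finset.mem_univ j), Function.update_self]
  congr 1
  exact Finset.prod_congr rfl fun l hl => by
    rw [Function.update_of_ne (Finset.ne_of_mem_erase hl)]

/-- The theta function `∑ c j * sigma (z - a j + u) * ∏_{l ≠ j} sigma (z - a l)`. -/
def thetaSum (L : PeriodPair) (a : Fin N → ℂ) (u : ℂ) (c : Fin N → ℂ) (z : ℂ) : ℂ :=
  ∑ j, c j * ellipticPoly L (Function.update a j (a j - u)) z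

variable {a : Fin N → ℂ} {u : ℂ} {c : Fin N → ℂ}

lemma isTheta_thetaSum : IsTheta L N (∑ i, a i - u) (thetaSum L a u c) := by
  refine IsTheta.sum fun j => ((IsTheta.ellipticPoly _).const_mul _).congr rfl ?_
  rw [Finset.sum_update_of_mem (Finset.mem_univ j), ← Finset.erase_eq,
    ← Finset.add_sum_erase _ a (Finset.mem_univ j)]
  ring

/-- The value `∏_{l ≠ i} sigma (a i - a l)` at `a i` of the other factors. -/
def cofactor (L : PeriodPair) (a : Fin N → ℂ) (i : Fin N) : ℂ :=
  ∏ l ∈ Finset.univ.erase i, sigma L (a i - a l)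

lemma cofactor_ne_zero (ha : LatticeDistinct L a) (i : Fin N) : cofactor L a i ≠ 0 :=
  Finset.prod_ne_zero_iff.2 fun _ hl =>
    sigma_ne_zero L (ha i _ (Finset.ne_of_mem_erase hl).symm)

/-- At `a i` all other summands vanish. For points distinct modulo the lattice, `c` thus lists the
residues of `thetaSum / ellipticPoly` at the `a i`, up to the common factor `sigma L u`. -/
lemma thetaSum_self (i : Fin N) : thetaSum L a u c (a i) = c i * (sigma L u * cofactor L a i) := by
  rw [thetaSum, Finset.sum_eq_single i]
  · rw [ellipticPoly_update, sub_sub_cancel, cofactor]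
  · intro j _ hj
    rw [ellipticPoly_eq_zero_iff.2 ⟨i, by simp [Function.update_of_ne hj.symm]⟩, mul_zero]
  · simp

lemma thetaSum_self_ne_zero (ha : LatticeDistinct L a) (hu : u ∉ L.lattice) {i : Fin N}
    (hc : c i ≠ 0) : thetaSum L a u c (a i) ≠ 0 := by
  rw [thetaSum_self]
  exact mul_ne_zero hc (mul_ne_zero (sigma_ne_zero L hu) (cofactor_ne_zero ha i))

lemma eq_zero_of_thetaSum_eq_zero (ha : LatticeDistinct L a) (hu : u ∉ L.lattice)
    (h : ∀ z, thetaSum L a u c z = 0) : c = 0 :=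
  funext fun _ => by_contra fun hc => thetaSum_self_ne_zero ha hu hc (h _)

lemma thetaSum_smul (r z : ℂ) : thetaSum L a u (r • c) z = r * thetaSum L a u c z := by
  simp [thetaSum, Finset.mul_sum, mul_assoc]

lemma sum_mul_thetaSum {ι : Type*} [Fintype ι] (r : ι → ℂ) (c : ι → Fin N → ℂ) (z : ℂ) :
    ∑ i, r i * thetaSum L a u (c i) z = thetaSum L a u (∑ i, r i • c i) z := by
  simp only [thetaSum, Finset.mul_sum, Finset.sum_apply, Pi.smul_apply, smul_eq_mul,
    Finset.sum_mul]
  rw [Finset.sum_comm]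
  simp only [mul_assoc]

/-! ### The Lax matrix of the system and its time evolution -/

section Dynamics

variable {η lam : ℂ} {x : ℤ → Fin N → ℂ}

/-- The coefficients of the Lax matrix of the system. -/
def laxCoefficient (L : PeriodPair) (η lam : ℂ) (x : ℤ → Fin N → ℂ) (m : ℤ) (i j : Fin N) : ℂ :=
  lam * ellipticPoly L (x (m + 1)) (x m i) *
      (∏ l ∈ Finset.univ.erase j, sigma L (x m i - η - x m l)) /
    (cofactor L (x m) i * ellipticPoly L (x (m + 1)) (x m i - η))

/-- The Lax matrix of the system. -/
def lax (L : PeriodPair) (η lam : ℂ) (x : ℤ → Fin N → ℂ) (u : ℂ) (m : ℤ) :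
    Matrix (Fin N) (Fin N) ℂ :=
  laxAt L η (x m) (laxCoefficient L η lam x m) u

/-- The missing factor completes the product to `τ^m(x m i - η)`, which no longer depends on `j`. -/
lemma laxCoefficient_residue (m : ℤ) : ∃ ρ : Fin N → ℂ, ∀ i j,
    laxCoefficient L η lam x m i j * sigma L (x m i - x m j - η) = ρ i := by
  refine ⟨fun i => lam * ellipticPoly L (x (m + 1)) (x m i) * ellipticPoly L (x m) (x m i - η) /
    (cofactor L (x m) i * ellipticPoly L (x (m + 1)) (x m i - η)), fun i j => ?_⟩
  have h : ellipticPoly L (x m) (x m i - η) = sigma L (x m i - x m j - η) *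
      ∏ l ∈ Finset.univ.erase j, sigma L (x m i - η - x m l) := by
    rw [sub_right_comm, ellipticPoly, ← Finset.mul_prod_erase _ _ (Finset.mem_univ j)]
  simp only [h, laxCoefficient]
  ring

lemma lax_mulVec (hx : GenericPosition L η x) (hu : u ∉ L.lattice) (m : ℤ) (i : Fin N) :
    (lax L η lam x u m).mulVec c i *
        (sigma L u * cofactor L (x m) i * ellipticPoly L (x (m + 1)) (x m i - η)) =
      lam * thetaSum L (x m) u c (x m i - η) * ellipticPoly L (x (m + 1)) (x m i) := by
  have h1 := sigma_ne_zero L hu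
  have h2 := cofactor_ne_zero (hx.latticeDistinct m) i
  have h3 := hx.poly_next_sub m i
  rw [Matrix.mulVec, dotProduct, thetaSum, Finset.sum_mul, Finset.mul_sum, Finset.sum_mul]
  refine Finset.sum_congr rfl fun j _ => ?_
  rw [ellipticPoly_update, show x m i - η - (x m j - u) = x m i - x m j - η + u by ring]
  simp only [lax, laxAt, Matrix.of_apply, laxCoefficient]
  field_simp

/-- The eigenvector equation is the relation `IsEntireSolution.at_pole`: the left side of the step
equation must vanish at `x m i - η`, because the right side does. -/
lemma lax_mulVec_eq_smul_iff (hx : GenericPosition L η x) (hu : u ∉ L.lattice) (m : ℤ) {k : ℂ} :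
    (lax L η lam x u m).mulVec c = k • c ↔
      ∀ i, k * thetaSum L (x m) u c (x m i) * ellipticPoly L (x (m + 1)) (x m i - η) =
        lam * thetaSum L (x m) u c (x m i - η) * ellipticPoly L (x (m + 1)) (x m i) := by
  rw [funext_iff]
  refine forall_congr' fun i => ?_
  rw [← lax_mulVec hx hu, thetaSum_self, Pi.smul_apply, smul_eq_mul, eq_comm]
  have h : sigma L u * cofactor L (x m) i * ellipticPoly L (x (m + 1)) (x m i - η) ≠ 0 :=
    mul_ne_zero (mul_ne_zero (sigma_ne_zero L hu) (cofactor_ne_zero (hx.latticeDistinct m) i))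
      (hx.poly_next_sub m i)
  rw [← mul_left_inj' h]
  simp only [mul_assoc]

lemma LatticeDistinct.sub_const (ha : LatticeDistinct L a) (b : ℂ) :
    LatticeDistinct L fun i => a i - b := fun i j hij => by
  rw [sub_sub_sub_cancel_right]
  exact ha i j hij

/-- A kernel vector gives a theta function vanishing at the `N` points `x m i - η`. Their sum
exceeds the admissible one by `u - N * η`, so the function is zero. -/
lemma lax_det_ne_zero (hx : GenericPosition L η x) (hlam : lam ≠ 0) (hu : u ∉ L.lattice)
    (hu' : u - N * η ∉ L.lattice) (m : ℤ) : (lax L η lam x u m).det ≠ 0 := by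
  intro h
  obtain ⟨c, hc, h⟩ := Matrix.exists_mulVec_eq_zero_iff.2 h
  refine hc (eq_zero_of_thetaSum_eq_zero (hx.latticeDistinct m) hu (congrFun ?_))
  refine isTheta_thetaSum.eq_zero ((hx.latticeDistinct m).sub_const η) (fun i => ?_) ?_
  · have h1 := lax_mulVec (lam := lam) (c := c) hx hu m i
    rw [h, Pi.zero_apply, zero_mul, eq_comm] at h1
    simpa [hlam, hx.poly_next m i] using h1
  · rw [Finset.sum_sub_distrib]
    convert hu' using 2
    simp

/-- The evolution step relating coefficient vectors at consecutive times. -/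
def IsStep (L : PeriodPair) (η lam : ℂ) (x : ℤ → Fin N → ℂ) (u k : ℂ) (m : ℤ)
    (c c' : Fin N → ℂ) : Prop :=
  ∀ z, k * thetaSum L (x m) u c (z + η) * ellipticPoly L (x (m + 1)) z -
    lam * thetaSum L (x m) u c z * ellipticPoly L (x (m + 1)) (z + η) =
      thetaSum L (x (m + 1)) u c' z * ellipticPoly L (x m) (z + η)

lemma IsStep.smul {k : ℂ} {m : ℤ} {c c' : Fin N → ℂ} (h : IsStep L η lam x u k m c c') (r : ℂ) :
    IsStep L η lam x u k m (r • c) (r • c') := fun z => by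
  simp only [thetaSum_smul]
  linear_combination r * h z

/-- The difference of the two sides is a theta function of degree `2N`. It vanishes at the `x (m +
1) i` by the choice of `c'` and at the `x m i - η` by the eigenvector equation; the sum of these
zeros is off by `u`, so the difference is zero. -/
lemma exists_isStep (hx : GenericPosition L η x) (hu : u ∉ L.lattice) {m : ℤ} {k : ℂ}
    (hc : (lax L η lam x u m).mulVec c = k • c) : ∃ c', IsStep L η lam x u k m c c' := by
  rw [lax_mulVec_eq_smul_iff hx hu] at hc
  have hne : ∀ i, sigma L u * cofactor L (x (m + 1)) i *
      ellipticPoly L (x m) (x (m + 1) i + η) ≠ 0 := fun i =>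
    mul_ne_zero (mul_ne_zero (sigma_ne_zero L hu) (cofactor_ne_zero (hx.latticeDistinct _) i))
      (hx.poly_prev_add m i)
  -- Solved from the step equation at `x (m + 1) i`, where the term with `k` drops out.
  let c' : Fin N → ℂ := fun i => -(lam * thetaSum L (x m) u c (x (m + 1) i) *
    ellipticPoly L (x (m + 1)) (x (m + 1) i + η)) /
      (sigma L u * cofactor L (x (m + 1)) i * ellipticPoly L (x m) (x (m + 1) i + η))
  refine ⟨c', fun z => ?_⟩
  have hF : IsTheta L N (∑ i, x m i - u) (thetaSum L (x m) u c) := isTheta_thetaSum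
  have hτ : IsTheta L N (∑ i, x m i) (ellipticPoly L (x m)) := .ellipticPoly _
  have hτ' : IsTheta L N (∑ i, x (m + 1) i) (ellipticPoly L (x (m + 1))) := .ellipticPoly _
  have hF' : IsTheta L N (∑ i, x (m + 1) i - u) (thetaSum L (x (m + 1)) u c') := isTheta_thetaSum
  have hD : IsTheta L (N + N) (∑ i, x m i + ∑ i, x (m + 1) i - N * η - u) fun z =>
      k * (thetaSum L (x m) u c (z + η) * ellipticPoly L (x (m + 1)) z) -
        lam * (thetaSum L (x m) u c z * ellipticPoly L (x (m + 1)) (z + η)) -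
          thetaSum L (x (m + 1)) u c' z * ellipticPoly L (x m) (z + η) := by
    refine IsTheta.sub (IsTheta.sub (IsTheta.const_mul ?_ k) (IsTheta.const_mul ?_ lam)) ?_
    · exact ((hF.comp_add η).mul hτ').congr rfl (by ring)
    · exact (hF.mul (hτ'.comp_add η)).congr rfl (by ring)
    · exact (hF'.mul (hτ.comp_add η)).congr rfl (by ring)
  have hb : LatticeDistinct L (Fin.append (x (m + 1)) fun i => x m i - η) := by
    intro i j hij
    induction i using Fin.addCases with
    | left i =>
      induction j using Fin.addCases with
      | left j =>
        rw [Fin.append_left, Fin.append_left]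
        exact hx.latticeDistinct _ i j fun h => hij (by rw [h])
      | right j =>
        rw [Fin.append_left, Fin.append_right]
        exact fun h => (hx.next_time m j i).2 (by convert L.lattice.neg_mem h using 1; ring)
    | right i =>
      induction j using Fin.addCases with
      | left j =>
        rw [Fin.append_left, Fin.append_right]
        exact fun h => (hx.next_time m i j).2 (by convert h using 1; ring)
      | right j =>
        rw [Fin.append_right, Fin.append_right]
        exact (hx.latticeDistinct m).sub_const η i j fun h => hij (by rw [h])
  have h0 := hD.eq_zero hb (fun i => ?_) ?_
  · have := congrFun h0 z
    simp only [Pi.zero_apply] at this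
    linear_combination this
  · induction i using Fin.addCases with
    | left i =>
      have h1 : thetaSum L (x (m + 1)) u c' (x (m + 1) i) *
          ellipticPoly L (x m) (x (m + 1) i + η) = -(lam * thetaSum L (x m) u c (x (m + 1) i) *
            ellipticPoly L (x (m + 1)) (x (m + 1) i + η)) := by
        rw [thetaSum_self, mul_assoc]
        exact div_mul_cancel₀ _ (hne i)
      simp only [Fin.append_left, ellipticPoly_zero_self]
      linear_combination -h1
    | right i =>
      simp only [Fin.append_right, sub_add_cancel, ellipticPoly_zero_self]
      linear_combination hc i
  · rw [Fin.sum_univ_add]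
    simp only [Fin.append_left, Fin.append_right, Finset.sum_sub_distrib]
    convert hu using 2
    simp
    ring

/-- The elimination behind necessity is run backwards: two evaluations of the step and the equation
of motion give the third relation, the eigenvector equation at time `m + 1`. -/
lemma IsStep.mulVec_eq_smul (hx : GenericPosition L η x) (hu : u ∉ L.lattice)
    (heom : EquationsOfMotion L η x) {m : ℤ} {k : ℂ} {c' : Fin N → ℂ}
    (h : IsStep L η lam x u k m c c') : (lax L η lam x u (m + 1)).mulVec c' = k • c' := by
  rw [lax_mulVec_eq_smul_iff hx hu]
  intro i
  have h1 := h (x (m + 1) i)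
  have h2 := h (x (m + 1) i - η)
  rw [ellipticPoly_zero_self, mul_zero, zero_sub] at h1
  rw [sub_add_cancel, ellipticPoly_zero_self, mul_zero, sub_zero] at h2
  have h3 := (equationsOfMotion_iff hx).1 heom m i
  refine mul_right_cancel₀ (mul_ne_zero (hx.poly_prev_add m i) (hx.poly_prev m i)) ?_
  linear_combination (-k * ellipticPoly L (x m) (x (m + 1) i) *
    ellipticPoly L (x (m + 1 + 1)) (x (m + 1) i - η)) * h1 +
    lam * ellipticPoly L (x m) (x (m + 1) i + η) *
      ellipticPoly L (x (m + 1 + 1)) (x (m + 1) i) * h2 -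
    k * lam * thetaSum L (x m) u c (x (m + 1) i) * h3

/-- If `c' = 0`, the theta function of `c` vanishes at all `x (m + 1) i`, and `hu'` says that these
zeros have the wrong sum. -/
lemma IsStep.ne_zero (hx : GenericPosition L η x) (hlam : lam ≠ 0) (hu : u ∉ L.lattice) {m : ℤ}
    (hu' : u + (∑ i, x (m + 1) i - ∑ i, x m i) ∉ L.lattice) {k : ℂ} {c' : Fin N → ℂ}
    (h : IsStep L η lam x u k m c c') (hc : c ≠ 0) : c' ≠ 0 := by
  rintro rfl
  refine hc (eq_zero_of_thetaSum_eq_zero (hx.latticeDistinct m) hu (congrFun ?_))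
  refine isTheta_thetaSum.eq_zero (hx.latticeDistinct (m + 1)) (fun i => ?_) ?_
  · have h1 := h (x (m + 1) i)
    rw [ellipticPoly_zero_self, thetaSum_self] at h1
    simpa [hlam, hx.poly_same_add (m + 1) i] using h1
  · convert hu' using 2
    ring

end Dynamics

end DoubleBloch
end

noncomputable section
namespace DoubleBloch
open scoped Topology

/-! ### Compatible eigenvectors for simple spectrum -/

section Eigenvectors

lemma isRoot_charpoly_iff {n : Type*} [Fintype n] [DecidableEq n] {A : Matrix n n ℂ} {k : ℂ} :
    A.charpoly.IsRoot k ↔ ∃ c, c ≠ 0 ∧ A.mulVec c = k • c := by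
  have h : A.charpoly.eval k = (k • (1 : Matrix n n ℂ) - A).det := by
    rw [Matrix.charpoly, ← Polynomial.coe_evalRingHom, RingHom.map_det]
    congr 1
    ext i j
    by_cases hij : i = j
    · subst hij
      simp
    · simp [hij]
  rw [Polynomial.IsRoot, h, ← Matrix.exists_mulVec_eq_zero_iff]
  refine exists_congr fun c => and_congr_right fun _ => ?_
  rw [Matrix.sub_mulVec, Matrix.smul_mulVec, Matrix.one_mulVec, sub_eq_zero, eq_comm]

/-- If `c i = 0`, the remaining entries form an eigenvector of the submatrix for the same `k`, a
common root of the two polynomials. -/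
lemma eigenvector_apply_ne_zero {n : Type*} [Fintype n] [DecidableEq n] {A : Matrix n n ℂ}
    {i : n} (h : IsCoprime A.charpoly
      (A.submatrix (Subtype.val : {j // j ≠ i} → n) Subtype.val).charpoly)
    {k : ℂ} {c : n → ℂ} (hc : c ≠ 0) (hA : A.mulVec c = k • c) : c i ≠ 0 := by
  intro hi
  have h1 : A.charpoly.IsRoot k := isRoot_charpoly_iff.2 ⟨c, hc, hA⟩
  have h2 : (A.submatrix (Subtype.val : {j // j ≠ i} → n) Subtype.val).charpoly.IsRoot k := by
    refine isRoot_charpoly_iff.2 ⟨fun j => c j, fun h0 => hc ?_, ?_⟩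
    · funext j
      by_cases hj : j = i
      · rw [hj, hi]; rfl
      · exact congrFun h0 ⟨j, hj⟩
    · funext j
      have h3 := congrFun hA j
      rw [Matrix.mulVec, dotProduct, ← Finset.add_sum_erase _ _ (Finset.mem_univ i), hi, mul_zero,
        zero_add, Finset.sum_subtype _ (p := fun j => j ≠ i) (by simp)] at h3
      exact h3
  obtain ⟨p, q, hpq⟩ := h
  have := congrArg (Polynomial.eval k) hpq
  simp [h1.eq_zero, h2.eq_zero] at this

/-- Values in a group let the recursion run backwards in time as well. -/
lemma exists_int_seq {G : Type*} [Group G] (a : ℤ → G) :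
    ∃ α : ℤ → G, ∀ m, α (m + 1) = a m * α m := by
  let f : ℕ → G := fun n => Nat.rec 1 (fun n g => a n * g) n
  let g : ℕ → G := fun n => Nat.rec 1 (fun n h => (a (-(n + 1 : ℕ)))⁻¹ * h) n
  refine ⟨fun m => match m with
    | .ofNat n => f n
    | .negSucc n => g (n + 1), fun m => ?_⟩
  match m with
  | .ofNat n => rfl
  | .negSucc 0 =>
    change (1 : G) = a (-1) * ((a (-1))⁻¹ * 1)
    simp
  | .negSucc (n + 1) =>
    change g (n + 1) = a (Int.negSucc (n + 1)) * ((a (Int.negSucc (n + 1)))⁻¹ * g (n + 1))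
    simp

/-- Eigenvectors of a sequence of matrices with simple spectrum can be chosen compatibly with
a homogeneous relation that propagates eigenvectors. -/
lemma exists_eigenvector_sequences {N : ℕ} (hN : 0 < N) (A : ℤ → Matrix (Fin N) (Fin N) ℂ)
    (R : ℂ → ℤ → (Fin N → ℂ) → (Fin N → ℂ) → Prop)
    (hsep : ∀ m, (A m).charpoly.Separable)
    (hne : ∀ m (k : ℂ) (c : Fin N → ℂ), c ≠ 0 → (A m).mulVec c = k • c → ∀ i, c i ≠ 0)
    (hR : ∀ m (k : ℂ) (c : Fin N → ℂ), c ≠ 0 → (A m).mulVec c = k • c →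
      ∃ c' : Fin N → ℂ, c' ≠ 0 ∧ (A (m + 1)).mulVec c' = k • c' ∧ R k m c c')
    (hsmul : ∀ k m c c' (r : ℂ), R k m c c' → R k m (r • c) (r • c')) :
    ∃ (k : Fin N → ℂ) (c : Fin N → ℤ → Fin N → ℂ), Function.Injective k ∧
      (∀ r m, c r m ≠ 0) ∧ (∀ r m, (A m).mulVec (c r m) = k r • c r m) ∧
      ∀ r m, R (k r) m (c r m) (c r (m + 1)) := by
  classical
  let S : ℤ → Finset ℂ := fun m => (A m).charpoly.roots.toFinset
  have hmem : ∀ m (k : ℂ), k ∈ S m ↔ ∃ c : Fin N → ℂ, c ≠ 0 ∧ (A m).mulVec c = k • c := fun m k => by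
    rw [Multiset.mem_toFinset, Polynomial.mem_roots (Matrix.charpoly_monic _).ne_zero,
      isRoot_charpoly_iff]
  have hcard : ∀ m, (S m).card = N := fun m => by
    rw [Multiset.toFinset_card_of_nodup (Polynomial.nodup_roots (hsep m)),
      Polynomial.splits_iff_card_roots.1 (IsAlgClosed.splits _), Matrix.charpoly_natDegree_eq_dim,
      Fintype.card_fin]
  -- Propagation only gives an inclusion of spectra; the common cardinality `N` makes it an
  -- equality, which also allows going back in time.
  have hstep : ∀ m, S m = S (m + 1) := fun m => by
    refine Finset.eq_of_subset_of_card_le (fun k hk => ?_) (by rw [hcard, hcard])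
    obtain ⟨c, hc, hA⟩ := (hmem m k).1 hk
    obtain ⟨c', hc', hA', -⟩ := hR m k c hc hA
    exact (hmem _ k).2 ⟨c', hc', hA'⟩
  have hS : ∀ m, S m = S 0 := fun m => by
    induction m using Int.induction_on with
    | zero => rfl
    | succ i ih => rw [← hstep, ih]
    | pred i ih => rw [hstep, sub_add_cancel, ih]
  let e := (S 0).equivFinOfCardEq (hcard 0)
  have hv : ∀ r m, ∃ c : Fin N → ℂ, c ≠ 0 ∧ (A m).mulVec c = (e.symm r : ℂ) • c := fun r m =>
    (hmem m _).1 (by rw [hS]; exact (e.symm r).2)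
  choose v hv0 hv using hv
  have hunit : ∀ r m, ∃ a : ℂˣ, R (e.symm r) m (v r m) ((a : ℂ) • v r (m + 1)) := fun r m => by
    obtain ⟨c', hc', hA', hRc⟩ := hR m _ _ (hv0 r m) (hv r m)
    let i : Fin N := ⟨0, hN⟩
    have h1 := hne _ _ _ hc' hA' i
    have h2 := hne _ _ _ (hv0 r (m + 1)) (hv r (m + 1)) i
    -- Eigenspaces are lines: this combination has vanishing entry `i`, which no eigenvector has.
    have h3 : v r (m + 1) i • c' - c' i • v r (m + 1) = 0 := by
      by_contra h
      refine hne (m + 1) (e.symm r) _ h ?_ i ?_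
      · rw [Matrix.mulVec_sub, Matrix.mulVec_smul, Matrix.mulVec_smul, hA', hv, smul_sub,
          smul_comm, smul_comm (c' i)]
      · simp [mul_comm]
    refine ⟨Units.mk0 (c' i / v r (m + 1) i) (div_ne_zero h1 h2), ?_⟩
    convert hRc using 1
    rw [Units.val_mk0, div_eq_inv_mul, mul_smul, ← sub_eq_zero.1 h3, smul_smul,
      inv_mul_cancel₀ h2, one_smul]
  choose a ha using hunit
  -- The rescaling by `(α r m)⁻¹` absorbs the proportionality factors `a r m` at all times.
  choose α hα using fun r => exists_int_seq fun m => (a r m)⁻¹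
  have hα' : ∀ r m, (α r m : ℂ) = a r m * α r (m + 1) := fun r m => by
    rw [hα, Units.val_mul, Units.val_inv_eq_inv_val, mul_inv_cancel_left₀ (a r m).ne_zero]
  refine ⟨fun r => e.symm r, fun r m => ((α r m)⁻¹ : ℂ) • v r m,
    fun r s h => e.symm.injective (Subtype.ext h),
    fun r m => smul_ne_zero (inv_ne_zero (α r m).ne_zero) (hv0 r m), fun r m => ?_, fun r m => ?_⟩
  · rw [Matrix.mulVec_smul, hv, smul_comm]
  · convert hsmul _ _ _ _ ((α r m)⁻¹ : ℂ) (ha r m) using 1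
    rw [smul_smul, hα' r m, mul_inv_rev, mul_assoc, inv_mul_cancel₀ (a r m).ne_zero, mul_one]

end Eigenvectors

/-! ### Choice of the spectral parameter -/

section Generic

variable {L : PeriodPair} {N : ℕ} {η lam : ℂ} {x : ℤ → Fin N → ℂ}

lemma countable_compl_of_eventually_codiscrete {p : ℂ → Prop} (h : ∀ᶠ u in codiscrete ℂ, p u) :
    {u | ¬p u}.Countable := by
  rw [← Set.inter_univ {u | ¬p u}]
  refine (HereditarilyLindelofSpace.isLindelof _).countable_of_isDiscrete
    (isDiscrete_of_codiscreteWithin ?_)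
  simp only [Set.compl_ofPred, not_not]
  exact h

/-- The Bloch multipliers must not depend on time, so one `u` has to satisfy the conditions for all
`m`; each `m` excludes only countably many values. -/
lemma exists_forall_of_eventually_codiscrete {ι : Type*} [Countable ι] {p : ι → ℂ → Prop}
    (h : ∀ i, ∀ᶠ u in codiscrete ℂ, p i u) : ∃ u, ∀ i, p i u := by
  by_contra! hc
  refine not_countable_complex ?_
  refine (Set.countable_iUnion fun i => countable_compl_of_eventually_codiscrete (h i)).mono ?_
  intro u _
  simpa using hc u

lemma eventually_sub_notMem_lattice (c : ℂ) : ∀ᶠ u in codiscrete ℂ, u - c ∉ L.lattice := by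
  filter_upwards [ellipticPoly_nontrivial (L := L) (fun _ : Fin 1 => c)] with u hu h
  exact hu (ellipticPoly_eq_zero_iff.2 ⟨0, h⟩)

lemma eventually_generic (hN : 0 < N) (hlam : lam ≠ 0) (hx : GenericPosition L η x)
    (hη : ∀ d : ℕ, 0 < d → d < N → (d : ℂ) * η ∉ L.lattice) (m : ℤ) :
    ∀ᶠ u in codiscrete ℂ, u ∉ L.lattice ∧ (lax L η lam x u m).det ≠ 0 ∧
      u + (∑ i, x (m + 1) i - ∑ i, x m i) ∉ L.lattice ∧
      (lax L η lam x u m).charpoly.Separable ∧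
      ∀ i, IsCoprime (lax L η lam x u m).charpoly
        ((lax L η lam x u m).submatrix (Subtype.val : {j // j ≠ i} → Fin N)
          Subtype.val).charpoly := by
  have hu : ∀ᶠ u in codiscrete ℂ, u ∉ L.lattice := by
    simpa using eventually_sub_notMem_lattice (L := L) 0
  have hdet : ∀ᶠ u in codiscrete ℂ, (lax L η lam x u m).det ≠ 0 := by
    filter_upwards [hu, eventually_sub_notMem_lattice (L := L) (N * η)] with u h1 h2
    exact lax_det_ne_zero hx hlam h1 h2 m
  have hη' : ∀ d : ℕ, 0 < d → d < Fintype.card (Fin N) → (d : ℂ) * η ∉ L.lattice := by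
    simpa using hη
  have : Nonempty (Fin N) := ⟨⟨0, hN⟩⟩
  refine hu.and (hdet.and (Eventually.and ?_ ((eventually_charpoly_separable
    (laxCoefficient_residue m) hη' hdet).and (eventually_all.2 fun i =>
      eventually_charpoly_isCoprime_minor (laxCoefficient_residue m) hη' hdet i))))
  simpa only [sub_neg_eq_add] using
    eventually_sub_notMem_lattice (L := L) (-(∑ i, x (m + 1) i - ∑ i, x m i))

/-- The equations of motion yield compatible sequences of eigenvectors of the Lax matrices. -/
lemma exists_eigenvectors (hN : 0 < N) (hlam : lam ≠ 0) (hx : GenericPosition L η x)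
    (hη : ∀ d : ℕ, 0 < d → d < N → (d : ℂ) * η ∉ L.lattice) (heom : EquationsOfMotion L η x) :
    ∃ (u : ℂ) (k : Fin N → ℂ) (c : Fin N → ℤ → Fin N → ℂ), u ∉ L.lattice ∧
      Function.Injective k ∧ (∀ r, k r ≠ 0) ∧ (∀ r m i, c r m i ≠ 0) ∧
      (∀ m, LinearIndependent ℂ fun r => c r m) ∧
      ∀ r m, IsStep L η lam x u (k r) m (c r m) (c r (m + 1)) := by
  obtain ⟨u, hu⟩ := exists_forall_of_eventually_codiscrete fun m : ℤ =>
    eventually_generic hN hlam hx hη m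
  have hu0 := (hu 0).1
  have hne : ∀ m (k : ℂ) (c : Fin N → ℂ), c ≠ 0 → (lax L η lam x u m).mulVec c = k • c → ∀ i, c i ≠ 0 :=
    fun m k c hc hA i => eigenvector_apply_ne_zero ((hu m).2.2.2.2 i) hc hA
  obtain ⟨k, c, hk, hc0, hc, hR⟩ := exists_eigenvector_sequences hN (lax L η lam x u)
    (IsStep L η lam x u) (fun m => (hu m).2.2.2.1) hne (fun m k c hc hA => by
      obtain ⟨c', h⟩ := exists_isStep hx hu0 hA
      exact ⟨c', h.ne_zero hx hlam hu0 (hu m).2.2.1 hc, h.mulVec_eq_smul hx hu0 heom, h⟩)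
    (fun k m c c' r h => h.smul r)
  refine ⟨u, k, c, hu0, hk, fun r h => ?_, fun r m => hne m _ _ (hc0 r m) (hc r m),
    fun m => ?_, hR⟩
  · have h1 := hc r 0
    rw [h, zero_smul] at h1
    exact (hu 0).2.1 (Matrix.exists_mulVec_eq_zero_iff.1 ⟨_, hc0 r 0, h1⟩)
  · refine Module.End.eigenvectors_linearIndependent' (Matrix.toLin' (lax L η lam x u m)) k hk _
      fun r => ⟨Module.End.mem_eigenspace_iff.2 ?_, hc0 r m⟩
    rw [Matrix.toLin'_apply, hc]

end Generic

end DoubleBloch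
end

/-! ### Construction of the solutions and proof of the theorem -/

noncomputable section
namespace DoubleBloch
open scoped Topology

variable {L : PeriodPair} {N : ℕ} {η lam : ℂ} {x : ℤ → Fin N → ℂ}

lemma gauge_gauge (b c : ℂ) (B : ℂ × ℂ) : gauge L b (gauge L c B) = gauge L (b + c) B := by
  simp only [gauge, add_mul, Complex.exp_add]
  congr 1 <;> ring

lemma equivalentMultipliers_gauge (b c : ℂ) (B : ℂ × ℂ) :
    EquivalentMultipliers L (gauge L b B) (gauge L c B) :=
  ⟨c - b, by rw [gauge_gauge, sub_add_cancel]⟩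

lemma IsDoubleBloch.exp_mul {B : ℂ × ℂ} {f : ℂ → ℂ} (hf : IsDoubleBloch L B f) (b : ℂ) :
    IsDoubleBloch L (gauge L b B) fun z => Complex.exp (b * z) * f z := by
  have hexp : Differentiable ℂ fun z => Complex.exp (b * z) := by fun_prop
  refine ⟨hexp.meromorphic.fun_mul hf.meromorphic, ?_, ?_⟩
  · filter_upwards [hf.bloch₁] with z hz
    rw [hz, mul_add, Complex.exp_add, gauge]
    ring
  · filter_upwards [hf.bloch₂] with z hz
    rw [hz, mul_add, Complex.exp_add, gauge]
    ring

lemma eventually_div_mul_cancel (a : Fin N → ℂ) (H : ℂ → ℂ) :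
    (fun z => H z / ellipticPoly L a z * ellipticPoly L a z) =ᶠ[codiscrete ℂ] H := by
  filter_upwards [ellipticPoly_nontrivial (L := L) a] with z hz
  rw [div_mul_cancel₀ _ hz]

lemma simplePolesExactlyAt_div {a : Fin N → ℂ} (ha : LatticeDistinct L a) {H : ℂ → ℂ}
    (hH : Differentiable ℂ H) (h : ∀ z ∈ latticeTranslates L a, H z ≠ 0) :
    SimplePolesExactlyAt (latticeTranslates L a) fun z => H z / ellipticPoly L a z := by
  have hT := differentiable_ellipticPoly (L := L) a
  have hadd := meromorphicOrderAt_add_of_mul_eq (hH.meromorphic.fun_div hT.meromorphic) hT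
    (eventually_div_mul_cancel a H)
  refine ⟨fun z hz => ?_, fun z hz => ?_⟩
  · have h1 := hadd z
    rw [meromorphicOrderAt_eq_zero_of_ne_zero hT (mt ellipticPoly_eq_zero_iff.1 hz),
      add_zero] at h1
    rw [h1]
    exact (hH.analyticAt z).meromorphicOrderAt_nonneg
  · have h1 := hadd z
    rw [meromorphicOrderAt_ellipticPoly ha hz,
      meromorphicOrderAt_eq_zero_of_ne_zero hH (h z hz)] at h1
    revert h1
    cases meromorphicOrderAt (fun z => H z / ellipticPoly L a z) z with
    | top => intro h; exact absurd h (by decide)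
    | coe n =>
      intro h
      have h' : n + 1 = (0 : ℤ) := WithTop.coe_injective h
      have : n = (-1 : ℤ) := by omega
      rw [this]
      rfl

lemma linearProblem_of_isStep {u b k : ℂ} {c : ℤ → Fin N → ℂ} (hk : Complex.exp (b * η) = k)
    (h : ∀ m, IsStep L η lam x u k m (c m) (c (m + 1))) :
    LinearProblem L η lam x fun m z =>
      Complex.exp (b * z) * thetaSum L (x m) u (c m) z / ellipticPoly L (x m) z := by
  intro m
  filter_upwards [ellipticPoly_nontrivial (L := L) (x m), ellipticPoly_nontrivial (L := L) (x (m + 1)),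
    (tendsto_add_const_codiscrete η).eventually (ellipticPoly_nontrivial (L := L) (x m))]
    with z h1 h2 h3
  have h4 := h m z
  rw [coefficient, mul_add, Complex.exp_add, hk]
  field_simp
  linear_combination h4

/-- A number orthogonal to the lattice modulo `2πi` is zero. -/
lemma eq_zero_of_exp_eq_one {b : ℂ} (h : ∀ l : L.lattice, Complex.exp (b * l) = 1) : b = 0 := by
  obtain ⟨n₁, h₁⟩ := Complex.exp_eq_one_iff.1 (h (period₁ L))
  obtain ⟨n₂, h₂⟩ := Complex.exp_eq_one_iff.1 (h (period₂ L))
  change b * L.ω₁ = _ at h₁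
  change b * L.ω₂ = _ at h₂
  by_contra hb
  -- Eliminating `2πi` leaves an integral relation between the periods, which are independent over
  -- the reals.
  have h3 : (n₂ : ℂ) * L.ω₁ + (-n₁ : ℂ) * L.ω₂ = 0 :=
    mul_left_cancel₀ hb (by linear_combination (n₂ : ℂ) * h₁ - (n₁ : ℂ) * h₂)
  have h4 := LinearIndependent.pair_iff.1 L.indep (n₂ : ℝ) (-n₁ : ℝ) (by
    simpa [Complex.real_smul] using h3)
  have h5 : (n₁ : ℤ) = 0 := by
    have := h4.2
    simpa using this
  rw [h5] at h₁
  have h6 : L.ω₁ = 0 := by simpa [hb] using h₁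
  exact LinearIndependent.ne_zero 0 L.indep (by simpa using h6)

/-- Functions with exponential factors that distinguish them on the lattice are independent. -/
lemma eq_zero_of_sum_exp_mul {d : ℕ} {α : ℂ} {b : Fin N → ℂ} {H : Fin N → ℂ → ℂ}
    (hb : Function.Injective b) (hH : ∀ r, IsTheta L d α (H r))
    (h : ∀ z, ∑ r, Complex.exp (b r * z) * H r z = 0) (z : ℂ) (r : Fin N) : H r z = 0 := by
  -- For fixed `z`, translation by `l` multiplies all `H r z` by the same factor, so the relation
  -- becomes one between the characters `l ↦ exp (b r * l)`, which are distinct and hence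
  -- independent.
  let χ : Fin N → Multiplicative L.lattice →* ℂ := fun r =>
    { toFun := fun l => Complex.exp (b r * (l.toAdd : ℂ))
      map_one' := by simp
      map_mul' := fun l l' => by
        rw [← Complex.exp_add, toAdd_mul, Submodule.coe_add, mul_add] }
  have hχ : Function.Injective χ := by
    intro r s hrs
    refine hb (sub_eq_zero.1 (eq_zero_of_exp_eq_one (L := L) fun l => ?_))
    have h1 : Complex.exp (b r * l) = Complex.exp (b s * l) :=
      DFunLike.congr_fun hrs (Multiplicative.ofAdd l)
    rw [sub_mul, Complex.exp_sub, h1, div_self (Complex.exp_ne_zero _)]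
  have hind := (linearIndependent_monoidHom (Multiplicative L.lattice) ℂ).comp χ hχ
  have h1 := Fintype.linearIndependent_iff.1 hind (fun r => Complex.exp (b r * z) * H r z) (by
    funext l
    have h2 := h (z + (l.toAdd : ℂ))
    have h3 : sigmaFactor L l.toAdd ^ d * Complex.exp (quasiPeriod L l.toAdd * (d * z - α)) ≠ 0 :=
      mul_ne_zero (pow_ne_zero _ (sigmaFactor_ne_zero _)) (Complex.exp_ne_zero _)
    refine mul_left_cancel₀ h3 ?_
    rw [Pi.zero_apply, mul_zero, ← h2, Finset.sum_apply, Finset.mul_sum]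
    refine Finset.sum_congr rfl fun r _ => ?_
    rw [(hH r).add_period, mul_add, Complex.exp_add]
    change _ * (Complex.exp (b r * z) * H r z * Complex.exp (b r * (l.toAdd : ℂ))) = _
    ring) r
  simpa [Complex.exp_ne_zero] using h1

/-- Sufficiency of the equations of motion. -/
lemma exists_solutions (hlam : lam ≠ 0) (hx : GenericPosition L η x)
    (hη : ∀ d : ℕ, 0 < d → d < N → (d : ℂ) * η ∉ L.lattice) (heom : EquationsOfMotion L η x) :
    ∃ (ψ : Fin N → ℤ → ℂ → ℂ) (B : Fin N → ℂ × ℂ),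
      IsSolutionSystem L η lam x ψ B ∧
      (∀ r m, SimplePolesExactlyAt (latticeTranslates L (x m)) (ψ r m)) ∧
      Independent ψ ∧ NormalizedIndependent L ψ B := by
  rcases Nat.eq_zero_or_pos N with rfl | hN
  · exact ⟨fun r => r.elim0, fun r => r.elim0, ⟨fun r => r.elim0, fun r => r.elim0,
      fun r => r.elim0⟩, fun r => r.elim0, fun _ _ r => r.elim0, (0, 0), fun r => r.elim0,
      fun r => r.elim0, fun _ _ _ r => r.elim0⟩
  obtain ⟨u, k, c, hu, hk, hk0, hc, hind, hstep⟩ := exists_eigenvectors hN hlam hx hη heom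
  have hη0 : η ≠ 0 := fun h => hx.step (h ▸ L.lattice.zero_mem)
  -- Any logarithm of the eigenvalue serves; distinct eigenvalues give distinct exponents.
  let b : Fin N → ℂ := fun r => Complex.log (k r) / η
  have hb : ∀ r, Complex.exp (b r * η) = k r := fun r => by
    rw [div_mul_cancel₀ _ hη0, Complex.exp_log (hk0 r)]
  have hbinj : Function.Injective b := fun r s h => hk (by rw [← hb r, h, hb s])
  have hF : ∀ r m, IsTheta L N (∑ i, x m i - u) (thetaSum L (x m) u (c r m)) := fun r m =>
    isTheta_thetaSum
  have hF0 : ∀ r m, ∀ z ∈ latticeTranslates L (x m),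
      Complex.exp (b r * z) * thetaSum L (x m) u (c r m) z ≠ 0 := by
    rintro r m z ⟨i, hi⟩
    refine mul_ne_zero (Complex.exp_ne_zero _) ?_
    have h := (hF r m).add_period ⟨_, hi⟩ (x m i)
    rw [add_sub_cancel] at h
    rw [h]
    exact mul_ne_zero (mul_ne_zero (pow_ne_zero _ (sigmaFactor_ne_zero _))
      (Complex.exp_ne_zero _)) (thetaSum_self_ne_zero (hx.latticeDistinct m) hu (hc r m i))
  have hsum : ∀ (r m z), Complex.exp (b r * z) * thetaSum L (x m) u (c r m) z /
      ellipticPoly L (x m) z = Complex.exp (b r * z) *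
        (thetaSum L (x m) u (c r m) z / ellipticPoly L (x m) z) := fun r m z => mul_div_assoc _ _ _
  refine ⟨fun r m z => Complex.exp (b r * z) * thetaSum L (x m) u (c r m) z /
    ellipticPoly L (x m) z, fun r => gauge L (b r) (sigmaMultipliers L u),
    ⟨fun r => linearProblem_of_isStep (hb r) (hstep r), fun r m => ?_,
      fun r s => equivalentMultipliers_gauge _ _ _⟩, fun r m => ?_, fun d hd r => ?_,
    sigmaMultipliers L u, b, fun r => rfl, fun m d hd => ?_⟩
  · simp only [hsum]
    have h := (hF r m).isDoubleBloch_div (a := x m)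
    rw [sub_sub_cancel] at h
    exact h.exp_mul (b r)
  · exact simplePolesExactlyAt_div (hx.latticeDistinct m)
      (Differentiable.mul (by fun_prop) (hF r m).differentiable) (hF0 r m)
  -- Time `0` alone suffices: the distinct exponentials separate the summands, each of which is
  -- non-zero at a pole unless its coefficient is zero.
  · have h0 : (fun z => ∑ s, Complex.exp (b s * z) * (d s * thetaSum L (x 0) u (c s 0) z)) = 0 := by
      refine eq_of_eventuallyEq_codiscrete ?_ continuous_const ?_
      · refine continuous_finsetSum _ fun s _ => Continuous.mul (by fun_prop) ?_
        exact ((hF s 0).const_mul (d s)).differentiable.continuous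
      · filter_upwards [hd 0, ellipticPoly_nontrivial (L := L) (x 0)] with z h1 h2
        have h3 : (∑ s, Complex.exp (b s * z) * (d s * thetaSum L (x 0) u (c s 0) z)) /
            ellipticPoly L (x 0) z = 0 := by
          rw [← h1, Finset.sum_div]
          exact Finset.sum_congr rfl fun s _ => by ring
        exact (div_eq_zero_iff.1 h3).resolve_right h2
    have h1 := eq_zero_of_sum_exp_mul hbinj (fun s => (hF s 0).const_mul (d s)) (congrFun h0)
      (x 0 r) r
    exact (mul_eq_zero.1 h1).resolve_right
      (thetaSum_self_ne_zero (hx.latticeDistinct 0) hu (hc r 0 r))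
  -- Normalization removes the exponentials, so here independence comes from that of the
  -- eigenvectors at time `m`.
  · have h0 : (fun z => ∑ s, d s * thetaSum L (x m) u (c s m) z) = 0 := by
      refine eq_of_eventuallyEq_codiscrete ?_ continuous_const ?_
      · exact continuous_finsetSum _ fun s _ =>
          ((hF s m).const_mul (d s)).differentiable.continuous
      · filter_upwards [hd, ellipticPoly_nontrivial (L := L) (x m)] with z h1 h2
        have h3 : (∑ s, d s * thetaSum L (x m) u (c s m) z) / ellipticPoly L (x m) z = 0 := by
          rw [← h1, Finset.sum_div]
          refine Finset.sum_congr rfl fun s _ => ?_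
          rw [hsum, ← mul_assoc (Complex.exp (-(b s * z))), ← Complex.exp_add, neg_add_cancel,
            Complex.exp_zero, one_mul, mul_div_assoc]
        exact (div_eq_zero_iff.1 h3).resolve_right h2
    refine Fintype.linearIndependent_iff.1 (hind m) d ?_
    refine eq_zero_of_thetaSum_eq_zero (hx.latticeDistinct m) hu fun z => ?_
    rw [← sum_mul_thetaSum]
    exact congrFun h0 z

end DoubleBloch
end

theorem theorem3p1 (L : PeriodPair) (η lam : ℂ) (hlam : lam ≠ 0) (N : ℕ)
    (x : ℤ → Fin N → ℂ) (hx : GenericPosition L η x) :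
    -- necessity, for solutions with genuine poles, independent over ℂ
    ((∃ (ψ : Fin N → ℤ → ℂ → ℂ) (B : Fin N → ℂ × ℂ),
        IsSolutionSystem L η lam x ψ B ∧
        (∀ r m, SimplePolesExactlyAt (latticeTranslates L (x m)) (ψ r m)) ∧
        Independent ψ) → EquationsOfMotion L η x) ∧
    -- necessity, for solutions with at most simple poles, independent with common multipliers
    ((∃ (ψ : Fin N → ℤ → ℂ → ℂ) (B : Fin N → ℂ × ℂ),
        IsSolutionSystem L η lam x ψ B ∧
        (∀ r m, AtMostSimplePoles (latticeTranslates L (x m)) (ψ r m)) ∧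
        NormalizedIndependent L ψ B) → EquationsOfMotion L η x) ∧
    -- sufficiency, with the strongest form of the solutions
    ((∀ k : ℕ, 0 < k → k < N → (k : ℂ) * η ∉ L.lattice) → EquationsOfMotion L η x →
      ∃ (ψ : Fin N → ℤ → ℂ → ℂ) (B : Fin N → ℂ × ℂ),
        IsSolutionSystem L η lam x ψ B ∧
        (∀ r m, SimplePolesExactlyAt (latticeTranslates L (x m)) (ψ r m)) ∧
        Independent ψ ∧ NormalizedIndependent L ψ B) := by
  refine ⟨?_, ?_, exists_solutions hlam hx⟩
  · rintro ⟨ψ, B, hs, hp, -⟩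
    exact equationsOfMotion_of_simplePoles hlam hx hs.solves
      (fun r m => (hs.doubleBloch r m).meromorphic) hp
  · rintro ⟨ψ, B, hs, hp, hi⟩
    exact equationsOfMotion_of_normalizedIndependent hlam hx hs hp hi
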